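/- Graphs are undirected, may be infinite, may have loops, and have no multiple edges. $G\times H$ is the direct product: $((x,y),(x',y'))\in E(G\times H)$ iff $(x,x')\in E(G)$ and $(y,y')\in E(H)$. The power graph $K^H$ has as vertices all maps $V(H)\to V(K)$, with $(f,g)\in E(K^H)$ iff $(f(v),g(w))\in E(K)$ for all $(v,w)\in E(H)$. $\mathrm{Hom}(T,G)$ is the polyhedral complex whose cells are the families $\eta=(\eta(x))_{x\in V(T)}$ of finite nonempty subsets of $V(G)$, only finitely many of them of size $>1$, such that $\eta(x)\times\eta(y)\subseteq E(G)$ for all $(x,y)\in E(T)$; the cell $\eta$ is the product of the simplices on the sets $\eta(x)$. Its face poset $\mathcal F(\mathrm{Hom}(T,G))$ is ordered by componentwise inclusion, and $\mathrm{Bd}\,X=\Delta(\mathcal F(X))$ is the order complex of the face poset (barycentric subdivision). Complexes, and products of complexes (whose cells are the products of cells), carry the weak (CW) topology. A finite complex is one with finitely many cells. A complex collapses onto a subcomplex if a finite sequence of elementary collapses leads from one to the other. Two finite complexes are simple homotopy equivalent (in the sense of Whitehead) if some finite simplicial subdivisions of them are related by a finite sequence of elementary collapses, elementary expansions and isomorphisms.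 **Theorem.** Let $G,H,K$ be graphs. 1. $\mathrm{Hom}(G,H\times K)\simeq\mathrm{Hom}(G,H)\times\mathrm{Hom}(G,K)$ (homotopy equivalence). If $\mathrm{Hom}(G,H\times K)$ is a finite complex (for example if $G,H,K$ are finite), then $(\eta_1,\eta_2)\mapsto\big(x\mapsto\eta_1(x)\times\eta_2(x)\big)$ embeds the poset $\mathcal F(\mathrm{Hom}(G,H))\times\mathcal F(\mathrm{Hom}(G,K))$ in $\mathcal F(\mathrm{Hom}(G,H\times K))$; the complex $\mathrm{Bd}\,\mathrm{Hom}(G,H\times K)$ collapses onto the corresponding copy of $\Delta\big(\mathcal F(\mathrm{Hom}(G,H))\times\mathcal F(\mathrm{Hom}(G,K))\big)$, which is a subdivision of $\mathrm{Hom}(G,H)\times\mathrm{Hom}(G,K)$; and $\mathrm{Hom}(G,H\times K)$ is simple homotopy equivalent to $\mathrm{Hom}(G,H)\times\mathrm{Hom}(G,K)$. 2. If $H$ is finite, then $\mathrm{Hom}(G\times H,K)\simeq\mathrm{Hom}(G,K^H)$. If $\mathrm{Hom}(G,K^H)$ is a finite complex (for example if $G,H,K$ are finite), then $\eta\mapsto\big(x\mapsto\{f:V(H)\to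 V(K)\mid f(v)\in\eta(x,v)\text{ for all }v\in V(H)\}\big)$ embeds the poset $\mathcal F(\mathrm{Hom}(G\times H,K))$ in $\mathcal F(\mathrm{Hom}(G,K^H))$; the complex $\mathrm{Bd}\,\mathrm{Hom}(G,K^H)$ collapses onto the corresponding copy of $\mathrm{Bd}\,\mathrm{Hom}(G\times H,K)$; and $\mathrm{Hom}(G\times H,K)$ is simple homotopy equivalent to $\mathrm{Hom}(G,K^H)$. 3. If $H$ is finite, then $\mathrm{Hom}(H,K)$ is homotopy equivalent to the clique complex of the subgraph of $K^H$ induced by the set of all graph homomorphisms $H\to K$. -/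

import Mathlib

noncomputable section

/-! ### Graphs: undirected, loops allowed, no multiple edges -/

/-- An undirected graph with vertex set `V`, possibly infinite; loops are allowed, multiple edges
are not. -/
structure LoopGraph (V : Type*) where
  Adj : V → V → Prop
  symm : ∀ ⦃x y : V⦄, Adj x y → Adj y x

namespace LoopGraph

/-- Graph homomorphisms: maps of the vertex sets that send edges to edges. -/
def IsHom {V W : Type*} (G : LoopGraph V) (H : LoopGraph W) (f : V → W) : Prop :=
  ∀ x y, G.Adj x y → H.Adj (f x) (f y)

/-- The direct (categorical) product `G × H`. -/
def prod {V W : Type*} (G : LoopGraph V) (H : LoopGraph W) : LoopGraph (V × W) where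
  Adj p q := G.Adj p.1 q.1 ∧ H.Adj p.2 q.2
  symm _ _ h := ⟨G.symm h.1, H.symm h.2⟩

/-- The power graph `K ^ H`: its vertices are all maps `V(H) → V(K)`, and `f`, `g` are adjacent
when `f v`, `g w` are adjacent in `K` for every edge `(v, w)` of `H`. -/
def power {V W : Type*} (K : LoopGraph W) (H : LoopGraph V) : LoopGraph (V → W) where
  Adj f g := ∀ v w, H.Adj v w → K.Adj (f v) (g w)
  symm _ _ h v w hvw := K.symm (h w v (H.symm hvw))

/-- The subgraph induced by a set of vertices. -/
def induce {V : Type*} (G : LoopGraph V) (S : Set V) : LoopGraph S where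
  Adj x y := G.Adj x y
  symm _ _ h := G.symm h

/-- The clique complex: its simplices are the finite nonempty sets of vertices that are pairwise
adjacent. -/
def cliqueComplex {V : Type*} (G : LoopGraph V) : PreAbstractSimplicialComplex V where
  faces := {s | s.Nonempty ∧ (s : Set V).Pairwise G.Adj}
  isRelLowerSet_faces := fun _ hs =>
    ⟨hs.1, fun _ hts ht => ⟨ht, hs.2.mono (Finset.coe_subset.2 hts)⟩⟩

end LoopGraph

/-! ### Prodsimplicial complexes -/

/-- A subcomplex of the weak direct product of copies, indexed by `ι`, of the simplex with vertex
set `A`. A cell is a product `∏ i, σ i` of simplices, only finitely many of which have positive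
dimension; it is recorded by the family `i ↦ η i` of the vertex sets of its factors. -/
structure ProdsimplicialComplex (ι A : Type*) where
  cells : Set (ι → Finset A)
  nonempty : ∀ η ∈ cells, ∀ i, (η i).Nonempty
  finite_dim : ∀ η ∈ cells, {i | 1 < (η i).card}.Finite
  down_closed : ∀ η ∈ cells, ∀ θ : ι → Finset A,
    (∀ i, (θ i).Nonempty) → (∀ i, θ i ⊆ η i) → θ ∈ cells

namespace ProdsimplicialComplex

/-- The face poset: the cells, ordered by `η ≤ θ` iff `η i ⊆ θ i` for all `i`. -/
abbrev Face {ι A : Type*} (X : ProdsimplicialComplex ι A) : Type _ := {η // η ∈ X.cells}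

/-- The closed cell `∏ i, Δ^(η i)`, in barycentric coordinates: `p i a` is the coordinate of the
`i`-th component of `p` at the vertex `a`. -/
def closedCell {ι A : Type*} (η : ι → Finset A) : Set (ι → A → ℝ) :=
  {p | ∀ i, (∀ a, 0 ≤ p i a) ∧ (∀ a, a ∉ η i → p i a = 0) ∧ ∑ a ∈ η i, p i a = 1}

/-- The space `|X|`: the union of the closed cells (with the weak topology, see below). -/
def Realization {ι A : Type*} (X : ProdsimplicialComplex ι A) : Type _ :=
  {p : ι → A → ℝ // ∃ η ∈ X.cells, p ∈ closedCell η}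

/-- The inclusion of a closed cell in `|X|`. -/
def cellInclusion {ι A : Type*} (X : ProdsimplicialComplex ι A) (η : X.Face)
    (p : closedCell η.1) : X.Realization :=
  ⟨p.1, η.1, η.2, p.2⟩

/-- `|X|` carries the weak (CW) topology: a set is open iff its intersection with every closed
cell is open in that cell. -/
instance {ι A : Type*} (X : ProdsimplicialComplex ι A) : TopologicalSpace X.Realization :=
  ⨆ η : X.Face, TopologicalSpace.coinduced (X.cellInclusion η) inferInstance

/-- The product of two complexes, as a complex whose cells are the products of a cell of `X` and a
cell of `Y`. The factors of such a cell are indexed by the disjoint union `ι ⊕ κ`; those indexed by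
`ι` are simplices on vertices in `A`, those indexed by `κ` are simplices on vertices in `B`. -/
def prod {ι κ A B : Type*} (X : ProdsimplicialComplex ι A) (Y : ProdsimplicialComplex κ B) :
    ProdsimplicialComplex (ι ⊕ κ) (A ⊕ B) where
  cells := {ζ | ∃ η ∈ X.cells, ∃ θ ∈ Y.cells,
    ζ = Sum.elim (fun i => (η i).map Function.Embedding.inl)
      (fun j => (θ j).map Function.Embedding.inr)}
  nonempty := by
    rintro _ ⟨η, hη, θ, hθ, rfl⟩ (i | j)
    · simpa using X.nonempty η hη i
    · simpa using Y.nonempty θ hθ j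
  finite_dim := by
    rintro _ ⟨η, hη, θ, hθ, rfl⟩
    refine (((X.finite_dim η hη).image Sum.inl).union
      ((Y.finite_dim θ hθ).image Sum.inr)).subset ?_
    rintro (i | j) h
    · exact Or.inl ⟨i, by simpa using h, rfl⟩
    · exact Or.inr ⟨j, by simpa using h, rfl⟩
  down_closed := by
    classical
    rintro _ ⟨η, hη, θ, hθ, rfl⟩ ζ hne hsub
    have h1 : ∀ i, ∃ s ⊆ η i, ζ (Sum.inl i) = s.map Function.Embedding.inl := fun i => by
      obtain ⟨s, hs, h⟩ := Finset.subset_map_iff.1 (hsub (Sum.inl i))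
      exact ⟨s, hs, h⟩
    have h2 : ∀ j, ∃ s ⊆ θ j, ζ (Sum.inr j) = s.map Function.Embedding.inr := fun j => by
      obtain ⟨s, hs, h⟩ := Finset.subset_map_iff.1 (hsub (Sum.inr j))
      exact ⟨s, hs, h⟩
    choose s hs hs' using h1
    choose t ht ht' using h2
    refine ⟨s, X.down_closed η hη s (fun i => ?_) hs, t,
      Y.down_closed θ hθ t (fun j => ?_) ht, ?_⟩
    · have := hne (Sum.inl i)
      rw [hs' i] at this
      simpa using this
    · have := hne (Sum.inr j)
      rw [ht' j] at this
      simpa using this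
    · funext k
      rcases k with i | j
      · exact hs' i
      · exact ht' j

end ProdsimplicialComplex

/-- The complex `Hom(T, G)`: the cells are the families `η` of finite nonempty sets of vertices of
`G`, indexed by the vertices of `T` and with only finitely many members of more than one element,
such that `η x × η y ⊆ E(G)` for every edge `(x, y)` of `T`. -/
def homComplex {V W : Type*} (T : LoopGraph V) (G : LoopGraph W) : ProdsimplicialComplex V W where
  cells := {η | (∀ x, (η x).Nonempty) ∧ {x | 1 < (η x).card}.Finite ∧
    ∀ x y, T.Adj x y → ∀ a ∈ η x, ∀ b ∈ η y, G.Adj a b}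
  nonempty _ h := h.1
  finite_dim _ h := h.2.1
  down_closed _ h _ hne hsub :=
    ⟨hne, h.2.1.subset fun i hi => lt_of_lt_of_le hi (Finset.card_le_card (hsub i)),
      fun x y hxy a ha b hb => h.2.2 x y hxy a (hsub x ha) b (hsub y hb)⟩

/-! ### Simplicial complexes: order complexes, collapses, subdivisions -/

/-- The order complex `Δ(P)` of a poset: the simplices are the finite nonempty chains. -/
def orderComplex (P : Type*) [PartialOrder P] : PreAbstractSimplicialComplex P where
  faces := {s | s.Nonempty ∧ IsChain (· ≤ ·) (s : Set P)}
  isRelLowerSet_faces := fun _ hs =>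
    ⟨hs.1, fun _ hts ht => ⟨ht, hs.2.mono (Finset.coe_subset.2 hts)⟩⟩

/-- The barycentric subdivision `Bd X`: the order complex of the face poset. -/
def ProdsimplicialComplex.Bd {ι A : Type*} (X : ProdsimplicialComplex ι A) :
    PreAbstractSimplicialComplex X.Face :=
  orderComplex X.Face

namespace PreAbstractSimplicialComplex

/-- A simplicial complex as a prodsimplicial complex whose cells have a single factor. -/
def toProdsimplicial {V : Type*} (S : PreAbstractSimplicialComplex V) :
    ProdsimplicialComplex Unit V where
  cells := {η | η () ∈ S.faces}
  nonempty _ h _ := (S.isRelLowerSet_faces h).1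
  finite_dim _ _ := Set.toFinite _
  down_closed _ h _ hne hsub := (S.isRelLowerSet_faces h).2 (hsub ()) (hne ())

/-- The image of a simplicial complex under a map of the vertices. For an injective map, this is a
copy of the complex. -/
def image {V W : Type*} (S : PreAbstractSimplicialComplex V) (f : V → W) :
    PreAbstractSimplicialComplex W :=
  haveI := Classical.decEq W
  S.map f

/-- `L` arises from `K` by an elementary collapse: a pair `τ ⊂ σ` of simplices is removed, where
`dim τ = dim σ - 1` and `τ` is contained in no simplices other than `τ` and `σ` (so that `σ` is
maximal, and is the only maximal simplex containing `τ`). -/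
def ElementaryCollapse {V : Type*} (K L : PreAbstractSimplicialComplex V) : Prop :=
  ∃ σ ∈ K.faces, ∃ τ ∈ K.faces, τ ⊂ σ ∧ σ.card = τ.card + 1 ∧
    (∀ ρ ∈ K.faces, τ ⊆ ρ → ρ = τ ∨ ρ = σ) ∧ L.faces = K.faces \ {σ, τ}

/-- `K` collapses onto `L`: a finite sequence of elementary collapses leads from `K` to `L`. -/
def CollapsesOnto {V : Type*} (K L : PreAbstractSimplicialComplex V) : Prop :=
  Relation.ReflTransGen ElementaryCollapse K L

/-- A simplicial complex `S` is (via some identification of the underlying spaces) a subdivision of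
`X`: there is a homeomorphism `|S| ≃ |X|` that maps each closed simplex of `S` affinely into a
closed cell of `X`. -/
def IsSubdivision {V ι A : Type*} (S : PreAbstractSimplicialComplex V)
    (X : ProdsimplicialComplex ι A) : Prop :=
  ∃ h : S.toProdsimplicial.Realization ≃ₜ X.Realization,
    ∀ s ∈ S.toProdsimplicial.cells,
      (∃ η ∈ X.cells, ∀ p, p.1 ∈ ProdsimplicialComplex.closedCell s →
        (h p).1 ∈ ProdsimplicialComplex.closedCell η) ∧
      (∀ p q r, ∀ t ∈ Set.Icc (0 : ℝ) 1, p.1 ∈ ProdsimplicialComplex.closedCell s →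
        q.1 ∈ ProdsimplicialComplex.closedCell s → r.1 = (1 - t) • p.1 + t • q.1 →
        (h r).1 = (1 - t) • (h p).1 + t • (h q).1)

/-- Formal deformations: finite sequences of elementary collapses, their inverses (elementary
expansions) and renamings of the vertices. The supply of vertex names is `ℕ`, which is enough for
finite complexes. -/
def FormalDeformation (S T : PreAbstractSimplicialComplex ℕ) : Prop :=
  Relation.EqvGen (fun A B => ElementaryCollapse A B ∨ ∃ e : ℕ ≃ ℕ, A.image e = B) S T

end PreAbstractSimplicialComplex

namespace ProdsimplicialComplex

/-- Simple homotopy equivalence of finite complexes, in the sense of Whitehead: some finite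
simplicial subdivisions of `X` and of `Y` are related by a formal deformation. -/
def SimpleHomotopyEquivalent {ι κ A B : Type*} (X : ProdsimplicialComplex ι A)
    (Y : ProdsimplicialComplex κ B) : Prop :=
  ∃ S T : PreAbstractSimplicialComplex ℕ, S.faces.Finite ∧ T.faces.Finite ∧
    S.IsSubdivision X ∧ T.IsSubdivision Y ∧ S.FormalDeformation T

/-- Homotopy equivalence of the underlying spaces. -/
def HomotopyEquivalent {ι κ A B : Type*} (X : ProdsimplicialComplex ι A)
    (Y : ProdsimplicialComplex κ B) : Prop :=
  Nonempty (ContinuousMap.HomotopyEquiv X.Realization Y.Realization)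

end ProdsimplicialComplex

end

/-! All three statements follow from one pattern, `ProductDecomposition`. A cell `η` of a complex
`X` has projections, which form a cell `l η` of `Y`; conversely a cell `θ` of `Y` has a largest cell
`u θ` of `X` that projects into it, and each factor of `u θ` is a full product of factors of `θ`. So
`l` and `u` form a Galois connection of face posets, with `u` an order embedding. In part 1 the
projections are the two coordinates of `H × K`; in parts 2 and 3 they are the evaluations of maps at
the vertices of `H`.

Homotopy equivalence: a point of a realization is a family of finitely supported probability
distributions. Marginals realize `l` and product distributions realize `u`. The marginals of a
product are the given distributions, so one composite is the identity. The other sends the cell `η`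
into `u (l η)`, which contains `η`, so it is homotopic to the identity along straight lines
(`homotopic_id_of_common_cell`). Products of distributions need finite fibres of the index map `r`,
whence the finiteness of `H`; the complexes may be infinite.

Collapse: `u ∘ l` is a closure operator on the face poset. The order complex of a finite poset
collapses onto the closed elements (`ClosureOperator.collapsesOnto_restrict`), which here form a
copy of the face poset of `Y`. Simple homotopy equivalence then follows because barycentric
subdivision of a finite complex is a subdivision (`isSubdivision_image_Bd`): every point is a convex
combination of barycentres of a chain of cells, in exactly one way. -/

noncomputable section

/-! ### Elementary collapses: relabelling of vertices, and removal of a vertex whose link is a cone.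
-/

namespace PreAbstractSimplicialComplex

variable {V W : Type*}

theorem mem_faces_image {S : PreAbstractSimplicialComplex V} {f : V ↪ W} {t : Finset W} :
    t ∈ (S.image f).faces ↔ ∃ s ∈ S.faces, s.map f = t := by
  classical
  simp only [image, map, Set.mem_image, Finset.map_eq_image]

theorem image_image (S : PreAbstractSimplicialComplex V) {U : Type*} (f : V ↪ W) (g : W ↪ U) :
    (S.image f).image g = S.image (f.trans g) := by
  ext t
  simp only [mem_faces_image]
  constructor
  · rintro ⟨_, ⟨s, hs, rfl⟩, rfl⟩
    exact ⟨s, hs, by rw [Finset.map_map]⟩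
  · rintro ⟨s, hs, rfl⟩
    exact ⟨_, ⟨s, hs, rfl⟩, by rw [Finset.map_map]⟩

theorem finite_faces_image {S : PreAbstractSimplicialComplex V} (hS : S.faces.Finite)
    (f : V ↪ W) : (S.image f).faces.Finite := by
  refine (hS.image (Finset.map f)).subset fun t ht => ?_
  obtain ⟨s, hs, rfl⟩ := mem_faces_image.1 ht
  exact ⟨s, hs, rfl⟩

theorem ElementaryCollapse.image {K L : PreAbstractSimplicialComplex V}
    (h : ElementaryCollapse K L) (f : V ↪ W) : ElementaryCollapse (K.image f) (L.image f) := by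
  obtain ⟨σ, hσ, τ, hτ, hlt, hcard, hfree, hL⟩ := h
  refine ⟨σ.map f, mem_faces_image.2 ⟨σ, hσ, rfl⟩, τ.map f, mem_faces_image.2 ⟨τ, hτ, rfl⟩,
    Finset.map_ssubset_map.2 hlt, by simpa using hcard, ?_, ?_⟩
  · intro _ hρ' h
    obtain ⟨ρ, hρ, rfl⟩ := mem_faces_image.1 hρ'
    simpa only [Finset.map_inj] using hfree ρ hρ (Finset.map_subset_map.1 h)
  · ext t
    simp only [mem_faces_image, hL, Set.mem_sdiff, Set.mem_insert_iff, Set.mem_singleton_iff]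
    constructor
    · rintro ⟨s, ⟨hs, h⟩, rfl⟩
      exact ⟨⟨s, hs, rfl⟩, by simpa only [Finset.map_inj] using h⟩
    · rintro ⟨⟨s, hs, rfl⟩, h⟩
      exact ⟨s, ⟨hs, by simpa only [Finset.map_inj] using h⟩, rfl⟩

theorem CollapsesOnto.image {K L : PreAbstractSimplicialComplex V}
    (h : CollapsesOnto K L) (f : V ↪ W) : CollapsesOnto (K.image f) (L.image f) :=
  Relation.ReflTransGen.lift (fun S => PreAbstractSimplicialComplex.image S f)
    (fun _ _ h => ElementaryCollapse.image h f) _ _ h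

theorem CollapsesOnto.formalDeformation {K L : PreAbstractSimplicialComplex ℕ}
    (h : CollapsesOnto K L) : FormalDeformation K L := by
  induction h with
  | refl => exact Relation.EqvGen.refl _
  | tail _ h ih => exact Relation.EqvGen.trans _ _ _ ih (Relation.EqvGen.rel _ _ (Or.inl h))

/-- The simplices all of whose vertices lie in `A`. -/
def restrict (K : PreAbstractSimplicialComplex V) (A : Set V) :
    PreAbstractSimplicialComplex V where
  faces := {s | s ∈ K.faces ∧ (s : Set V) ⊆ A}
  isRelLowerSet_faces := fun _ hs => ⟨(K.isRelLowerSet_faces hs.1).1, fun _ hts ht =>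
    ⟨(K.isRelLowerSet_faces hs.1).2 hts ht, (Finset.coe_subset.2 hts).trans hs.2⟩⟩

theorem restrict_restrict (K : PreAbstractSimplicialComplex V) (A B : Set V) :
    (K.restrict A).restrict B = K.restrict (A ∩ B) := by
  ext s
  simp [restrict, and_assoc]

/-- If the link of `x` is a cone with apex `y`, then the simplices that contain `x` can be
collapsed away. -/
theorem collapsesOnto_restrict_compl [DecidableEq V] {x y : V} (hxy : x ≠ y)
    (K : PreAbstractSimplicialComplex V) (hK : K.faces.Finite)
    (hcone : ∀ s ∈ K.faces, x ∈ s → insert y s ∈ K.faces) :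
    CollapsesOnto K (K.restrict {x}ᶜ) := by
  induction hn : {s ∈ K.faces | x ∈ s}.ncard using Nat.strong_induction_on generalizing K with
  | _ n ih =>
  have hfin : {s ∈ K.faces | x ∈ s ∧ y ∉ s}.Finite := hK.subset fun _ h => h.1
  by_cases hne : {s ∈ K.faces | x ∈ s ∧ y ∉ s}.Nonempty
  -- Simplices containing `x` are paired by adding or removing `y`. With `τ` of maximal size among
  -- those that miss `y`, its only proper coface is `insert y τ`, so this pair can be collapsed.
  · obtain ⟨τ, ⟨hτ, hxτ, hyτ⟩, hmax⟩ := hfin.exists_maximalFor Finset.card _ hne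
    have hfree : ∀ ρ ∈ K.faces, τ ⊆ ρ → ρ = τ ∨ ρ = insert y τ := by
      intro ρ hρ h
      by_cases hy : y ∈ ρ
      · right
        have h1 : τ ⊆ ρ.erase y := fun z hz =>
          Finset.mem_erase.2 ⟨fun e => hyτ (e ▸ hz), h hz⟩
        have h2 : ρ.erase y ∈ K.faces :=
          (K.isRelLowerSet_faces hρ).2 (Finset.erase_subset _ _) ⟨x, h1 hxτ⟩
        have h3 := hmax ⟨h2, h1 hxτ, by simp⟩ (Finset.card_le_card h1)
        rw [Finset.eq_of_subset_of_card_le h1 h3, Finset.insert_erase hy]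
      · left
        exact (Finset.eq_of_subset_of_card_le h
          (hmax ⟨hρ, h hxτ, hy⟩ (Finset.card_le_card h))).symm
    let L : PreAbstractSimplicialComplex V :=
      { faces := K.faces \ {insert y τ, τ}
        isRelLowerSet_faces := by
          rintro s ⟨hs, hs'⟩
          refine ⟨(K.isRelLowerSet_faces hs).1, fun t hts ht =>
            ⟨(K.isRelLowerSet_faces hs).2 hts ht, ?_⟩⟩
          rintro h
          have : τ ⊆ t := by
            rcases h with rfl | rfl
            · exact Finset.subset_insert _ _
            · exact subset_rfl
          rcases hfree s hs (this.trans hts) with rfl | rfl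
          · exact hs' (Or.inr rfl)
          · exact hs' (Or.inl rfl) }
    have hKL : ElementaryCollapse K L :=
      ⟨insert y τ, hcone τ hτ hxτ, τ, hτ, Finset.ssubset_insert hyτ,
        Finset.card_insert_of_notMem hyτ, hfree, rfl⟩
    have hrec : CollapsesOnto L (L.restrict {x}ᶜ) := by
      refine ih _ ?_ L (hK.subset Set.sdiff_subset) ?_ rfl
      · rw [← hn]
        refine Set.ncard_lt_ncard ⟨fun s hs => ⟨hs.1.1, hs.2⟩, fun h => ?_⟩
          (hK.subset fun _ h => h.1)
        exact (h (⟨hτ, hxτ⟩ : τ ∈ {s ∈ K.faces | x ∈ s})).1.2 (Or.inr rfl)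
      · rintro s ⟨hs, hs'⟩ hxs
        refine ⟨hcone s hs hxs, ?_⟩
        rintro (h | h)
        · have : τ ⊆ insert y s := h ▸ Finset.subset_insert _ _
          have : τ ⊆ s := fun z hz => (Finset.mem_insert.1 (this hz)).resolve_left
            fun e => hyτ (e ▸ hz)
          rcases hfree s hs this with rfl | rfl
          · exact hs' (Or.inr rfl)
          · exact hs' (Or.inl rfl)
        · exact hyτ (h ▸ Finset.mem_insert_self _ _)
    have heq : L.restrict {x}ᶜ = K.restrict {x}ᶜ := by
      ext s
      simp only [restrict, Set.subset_compl_singleton_iff, Set.mem_ofPred_eq, Finset.mem_coe]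
      refine ⟨fun h => ⟨h.1.1, h.2⟩, fun h => ⟨⟨h.1, ?_⟩, h.2⟩⟩
      rintro (rfl | rfl)
      · exact h.2 (Finset.mem_insert_of_mem hxτ)
      · exact h.2 hxτ
    rw [← heq]
    exact Relation.ReflTransGen.head hKL hrec
  -- If every simplex through `x` contains `y`, there is none: erasing `y` from one would leave a
  -- simplex through `x` that misses `y`.
  · have heq : K.restrict {x}ᶜ = K := by
      ext s
      simp only [restrict, Set.subset_compl_singleton_iff, Set.mem_ofPred_eq, Finset.mem_coe]
      refine ⟨fun h => h.1, fun h => ⟨h, fun hxs => hne ⟨s.erase y, ?_, ?_, by simp⟩⟩⟩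
      · exact (K.isRelLowerSet_faces h).2 (Finset.erase_subset _ _)
          ⟨x, Finset.mem_erase.2 ⟨hxy, hxs⟩⟩
      · exact Finset.mem_erase.2 ⟨hxy, hxs⟩
    rw [heq]
    exact Relation.ReflTransGen.refl

end PreAbstractSimplicialComplex

open PreAbstractSimplicialComplex

/-! ### Collapsing order complexes along closure operators and Galois connections. -/

theorem finite_faces_orderComplex (P : Type*) [PartialOrder P] [Finite P] :
    (orderComplex P).faces.Finite :=
  Set.toFinite _

/-- The order complex of a finite poset collapses onto that of the closed elements of a closure
operator, one non-closed element being removed at a time, from the top. -/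
theorem ClosureOperator.collapsesOnto_restrict {P : Type*} [PartialOrder P] [Finite P]
    (c : ClosureOperator P) :
    CollapsesOnto (orderComplex P) ((orderComplex P).restrict {x | c.IsClosed x}) := by
  classical
  suffices h : ∀ A : Set P, {x | c.IsClosed x} ⊆ A →
      CollapsesOnto ((orderComplex P).restrict A)
        ((orderComplex P).restrict {x | c.IsClosed x}) by
    have h1 := h Set.univ (Set.subset_univ _)
    rwa [show (orderComplex P).restrict Set.univ = orderComplex P by
      ext; simp [restrict]] at h1
  intro A
  induction hn : A.ncard using Nat.strong_induction_on generalizing A with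
  | _ n ih =>
  intro hA
  by_cases hne : (A \ {x | c.IsClosed x}).Nonempty
  -- By maximality every element of `A` strictly above `x` is closed, hence lies above `c x`, while
  -- elements below `x` lie below `c x`. So the link of `x` is a cone with apex `c x`, which is in
  -- `A` because it is closed.
  · obtain ⟨x, hx⟩ := (Set.toFinite (A \ {x | c.IsClosed x})).exists_maximal hne
    have hxc : x ≠ c x := fun h => hx.1.2 (c.isClosed_iff.2 h.symm)
    have h1 : CollapsesOnto ((orderComplex P).restrict A)
        (((orderComplex P).restrict A).restrict {x}ᶜ) := by
      refine collapsesOnto_restrict_compl hxc _ (Set.toFinite _) ?_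
      rintro s ⟨⟨-, hs⟩, hsA⟩ hxs
      refine ⟨⟨Finset.insert_nonempty _ _, ?_⟩, ?_⟩
      · rw [Finset.coe_insert]
        refine hs.insert fun z hz _ => ?_
        rcases hs.total hz hxs with h | h
        · exact Or.inr (h.trans (c.le_closure x))
        · by_cases hzc : c.IsClosed z
          · exact Or.inl (hzc.closure_le_iff.2 h)
          · exact Or.inr ((hx.2 ⟨hsA hz, hzc⟩ h).trans (c.le_closure x))
      · rw [Finset.coe_insert]
        exact Set.insert_subset (hA (c.isClosed_closure x)) hsA
    rw [restrict_restrict] at h1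
    refine h1.trans (ih _ ?_ _ rfl fun z hz => ⟨hA hz, ?_⟩)
    · rw [← hn]
      exact Set.ncard_lt_ncard ⟨Set.inter_subset_left, fun h => (h hx.1.1).2 rfl⟩
        (Set.toFinite _)
    · rintro rfl
      exact hx.1.2 hz
  · rw [Set.not_nonempty_iff_eq_empty, Set.sdiff_eq_empty] at hne
    rw [hne.antisymm hA]
    exact Relation.ReflTransGen.refl

/-- The closed elements of `u ∘ l` are exactly the values of `u`, and a chain of closed elements is
the image under `u` of its image under `l`. -/
theorem GaloisConnection.collapsesOnto_image {P Q : Type*} [PartialOrder P] [PartialOrder Q]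
    [Finite P] {l : P → Q} {u : Q ↪o P} (gc : GaloisConnection l u) :
    CollapsesOnto (orderComplex P) ((orderComplex Q).image u) := by
  convert gc.closureOperator.collapsesOnto_restrict using 1
  have hlu : ∀ q, l (u q) = q := fun q => u.injective (gc.u_l_u_eq_u q)
  ext s
  change s ∈ ((orderComplex Q).image u.toEmbedding).faces ↔ _
  rw [mem_faces_image]
  constructor
  · rintro ⟨t, ⟨ht, hch⟩, rfl⟩
    refine ⟨⟨ht.map, ?_⟩, ?_⟩
    · rw [Finset.coe_map]
      exact hch.image_of_map_rel _ _ _ fun _ _ h => u.monotone h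
    · intro z hz
      obtain ⟨q, -, rfl⟩ := Finset.mem_map.1 (Finset.mem_coe.1 hz)
      exact gc.closureOperator.isClosed_iff.2 (gc.u_l_u_eq_u q)
  · rintro ⟨⟨hs, hch⟩, hcl⟩
    have hul : ∀ z ∈ s, u (l z) = z := fun z hz => gc.closureOperator.isClosed_iff.1 (hcl hz)
    classical
    refine ⟨s.image l, ⟨hs.image _, ?_⟩, ?_⟩
    · rw [Finset.coe_image]
      exact hch.image_of_map_rel _ _ _ fun _ _ h => gc.monotone_l h
    · ext z
      simp only [Finset.mem_map, Finset.mem_image]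
      constructor
      · rintro ⟨_, ⟨w, hw, rfl⟩, rfl⟩
        exact (hul w hw).symm ▸ hw
      · exact fun hz => ⟨l z, ⟨z, hz, rfl⟩, hul z hz⟩
end

/-! ### Maps and straight-line homotopies between realizations in the weak topology. -/

noncomputable section

namespace ProdsimplicialComplex

variable {ι κ A B : Type*}

theorem continuous_cellInclusion (X : ProdsimplicialComplex ι A) (η : X.Face) :
    Continuous (X.cellInclusion η) :=
  continuous_iff_coinduced_le.2 (le_iSup (fun η : X.Face =>
    TopologicalSpace.coinduced (X.cellInclusion η) inferInstance) η)

theorem continuous_realization_iff {X : ProdsimplicialComplex ι A} {Z : Type*}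
    [TopologicalSpace Z] {f : X.Realization → Z} :
    Continuous f ↔ ∀ η : X.Face, Continuous (f ∘ X.cellInclusion η) := by
  rw [continuous_iSup_dom]
  exact forall_congr' fun _ => continuous_coinduced_dom

/-- Barycentric coordinates are continuous. -/
theorem continuous_coord (X : ProdsimplicialComplex ι A) :
    Continuous fun p : X.Realization => p.1 :=
  continuous_realization_iff.2 fun _ => continuous_subtype_val

/-- A map into `|Y|` is continuous if its image lies in one closed cell and its coordinates are
continuous. -/
theorem continuous_of_mem_closedCell {Y : ProdsimplicialComplex κ B} {Z : Type*}
    [TopologicalSpace Z] {f : Z → Y.Realization} (θ : Y.Face)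
    (hθ : ∀ z, (f z).1 ∈ closedCell θ.1) (hf : Continuous fun z => (f z).1) : Continuous f :=
  (Y.continuous_cellInclusion θ).comp (hf.subtype_mk hθ)

/-- The map of realizations given by a map of the coordinates that sends closed cells continuously
into closed cells. -/
def realizationMap {X : ProdsimplicialComplex ι A} {Y : ProdsimplicialComplex κ B}
    (F : (ι → A → ℝ) → κ → B → ℝ) (φ : X.Face → Y.Face)
    (hF : ∀ η : X.Face, Set.MapsTo F (closedCell η.1) (closedCell (φ η).1))
    (hc : ∀ η : X.Face, ContinuousOn F (closedCell η.1)) : C(X.Realization, Y.Realization) where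
  toFun p := ⟨F p.1, by
    obtain ⟨η, hη, hp⟩ := p.2
    exact ⟨_, (φ ⟨η, hη⟩).2, hF ⟨η, hη⟩ hp⟩⟩
  continuous_toFun := continuous_realization_iff.2 fun η =>
    continuous_of_mem_closedCell (φ η) (fun p => hF η p.2)
      (continuousOn_iff_continuous_domRestrict.1 (hc η))

theorem convex_closedCell (η : ι → Finset A) : Convex ℝ (closedCell η) := by
  intro p hp q hq a b ha hb hab i
  refine ⟨fun x => ?_, fun x hx => ?_, ?_⟩
  · have := (hp i).1 x
    have := (hq i).1 x
    simp only [Pi.add_apply, Pi.smul_apply, smul_eq_mul]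
    positivity
  · simp [(hp i).2.1 x hx, (hq i).2.1 x hx]
  · simp only [Pi.add_apply, Pi.smul_apply, smul_eq_mul, Finset.sum_add_distrib,
      ← Finset.mul_sum, (hp i).2.2, (hq i).2.2]
    linarith

theorem closedCell_mono {η θ : ι → Finset A} (h : η ≤ θ) : closedCell η ⊆ closedCell θ := by
  intro p hp i
  refine ⟨(hp i).1, fun a ha => (hp i).2.1 a fun h' => ha (h i h'), ?_⟩
  rw [← (hp i).2.2]
  exact (Finset.sum_subset (h i) fun a _ ha => (hp i).2.1 a ha).symm

/-- A self-map of `|X|` that shares a closed cell with the identity on each closed cell is homotopic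
to the identity, by a straight-line homotopy. -/
theorem homotopic_id_of_common_cell {X : ProdsimplicialComplex ι A}
    (F : C(X.Realization, X.Realization))
    (hF : ∀ η : X.Face, ∃ θ : X.Face, ∀ p : X.Realization, p.1 ∈ closedCell η.1 →
      p.1 ∈ closedCell θ.1 ∧ (F p).1 ∈ closedCell θ.1) :
    F.Homotopic (ContinuousMap.id _) := by
  have hmem : ∀ (θ : X.Face) (p : X.Realization) (t : unitInterval), p.1 ∈ closedCell θ.1 →
      (F p).1 ∈ closedCell θ.1 →
      (1 - t.1) • (F p).1 + t.1 • p.1 ∈ closedCell θ.1 := fun θ p t h1 h2 =>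
    convex_closedCell _ h2 h1 (by linarith [t.2.2]) t.2.1 (by ring)
  let h : X.Realization → unitInterval → X.Realization := fun p t =>
    ⟨(1 - t.1) • (F p).1 + t.1 • p.1, by
      obtain ⟨η, hη, hp⟩ := p.2
      obtain ⟨θ, hθ⟩ := hF ⟨η, hη⟩
      exact ⟨θ.1, θ.2, hmem θ p t (hθ p hp).1 (hθ p hp).2⟩⟩
  -- This is continuity for the topology of coordinatewise convergence only, which may be coarser
  -- than the weak topology; it becomes sufficient once the image lies in one closed cell.
  have hval : Continuous fun z : X.Realization × unitInterval => (h z.1 z.2).1 := by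
    have h1 := (X.continuous_coord.comp F.continuous)
    have h2 := X.continuous_coord
    exact ((continuous_const.sub (continuous_subtype_val.comp continuous_snd)).smul
      (h1.comp continuous_fst)).add
        ((continuous_subtype_val.comp continuous_snd).smul (h2.comp continuous_fst))
  have hcell : ∀ η : X.Face, Continuous fun z : closedCell η.1 × unitInterval =>
      h (X.cellInclusion η z.1) z.2 := by
    intro η
    obtain ⟨θ, hθ⟩ := hF η
    refine continuous_of_mem_closedCell θ (fun z => ?_) (hval.comp
      (((X.continuous_cellInclusion η).comp continuous_fst).prodMk continuous_snd))
    have := hθ (X.cellInclusion η z.1) z.1.2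
    exact hmem θ _ _ this.1 this.2
  have hslice : ∀ p, Continuous (h p) := by
    intro p
    obtain ⟨η, hη, hp⟩ := p.2
    exact (hcell ⟨η, hη⟩).comp (Continuous.prodMk_right (⟨p.1, hp⟩ : closedCell η))
  -- Currying lets continuity be tested cell by cell on `X.Realization` alone; since the unit
  -- interval is locally compact, uncurrying returns a jointly continuous map.
  let h' : X.Realization → C(unitInterval, X.Realization) := fun p => ⟨h p, hslice p⟩
  have hh' : Continuous h' := continuous_realization_iff.2 fun η =>
    ContinuousMap.continuous_of_continuous_uncurry _ (hcell η)
  have hh : Continuous fun z : X.Realization × unitInterval => h z.1 z.2 :=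
    ContinuousMap.continuous_uncurry_of_continuous ⟨h', hh'⟩
  refine ⟨⟨⟨fun z => h z.2 z.1, hh.comp continuous_swap⟩, fun p => ?_, fun p => ?_⟩⟩
  · exact Subtype.ext (by simp [h])
  · exact Subtype.ext (by simp [h])

/-! ### Product decompositions: Galois connection, marginals and product distributions. -/

/-- A relation between two complexes `X` and `Y`: the cell `θ` of `Y` gives a cell `u θ` of `X` whose
factor at `x` is the product, with projections `π`, of the factors of `θ` over the fibre of
`r : κ → ι` at `x`; the cell `η` of `X` gives the cell `l η` of `Y` of its projections. -/
structure ProductDecomposition (X : ProdsimplicialComplex ι A) (Y : ProdsimplicialComplex κ B) where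
  r : κ → ι
  π : κ → A → B
  l : X.Face → Y.Face
  u : Y.Face → X.Face
  mem_l : ∀ η k b, b ∈ (l η).1 k ↔ ∃ a ∈ η.1 (r k), π k a = b
  mem_u : ∀ θ x a, a ∈ (u θ).1 x ↔ ∀ k, r k = x → π k a ∈ θ.1 k
  ext : ∀ x a a', (∀ k, r k = x → π k a = π k a') → a = a'
  exists_eq : ∀ (θ : Y.Face) x (b : κ → B), (∀ k, b k ∈ θ.1 k) → ∃ a, ∀ k, r k = x → π k a = b k

namespace ProductDecomposition

variable {X : ProdsimplicialComplex ι A} {Y : ProdsimplicialComplex κ B}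
  (D : ProductDecomposition X Y)

theorem gc : GaloisConnection D.l D.u := by
  intro η θ
  constructor
  · intro h x a ha
    rw [D.mem_u]
    rintro k rfl
    exact h k ((D.mem_l _ _ _).2 ⟨a, ha, rfl⟩)
  · intro h k b hb
    obtain ⟨a, ha, rfl⟩ := (D.mem_l _ _ _).1 hb
    exact (D.mem_u _ _ _).1 (h _ ha) k rfl

/-- The section `u`, as an embedding of the face posets. -/
def embedding : Y.Face ↪o X.Face :=
  OrderEmbedding.ofMapLEIff D.u fun θ θ' => by
    classical
    refine ⟨fun h k b hb => ?_, fun h => D.gc.monotone_u h⟩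
    -- To see `b` in the factor of `θ'` at `k`, lift a section of `θ` with value `b` at `k` to a
    -- vertex of `u θ`, then project that vertex back at `k`.
    choose c hc using Y.nonempty θ.1 θ.2
    have hc' : ∀ k', Function.update c k b k' ∈ θ.1 k' := fun k' => by
      rcases eq_or_ne k' k with rfl | hk
      · simpa using hb
      · simpa [hk] using hc k'
    obtain ⟨a, ha⟩ := D.exists_eq θ (D.r k) _ hc'
    have h1 : a ∈ (D.u θ).1 (D.r k) := (D.mem_u _ _ _).2 fun k' hk' => ha k' hk' ▸ hc' k'
    have h2 := (D.mem_u _ _ _).1 (h _ h1) k rfl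
    rwa [ha k rfl, Function.update_self] at h2

theorem collapsesOnto [Finite X.Face] :
    X.Bd.CollapsesOnto (Y.Bd.image D.embedding) :=
  GaloisConnection.collapsesOnto_image (u := D.embedding) D.gc

/-- The marginal distributions. -/
def marginals (p : ι → A → ℝ) (k : κ) (b : B) : ℝ :=
  open scoped Classical in ∑ᶠ a, if D.π k a = b then p (D.r k) a else 0

/-- `marginals` must be defined without reference to a cell; on a fixed closed cell it becomes a
finite sum, which gives positivity, total mass and continuity. -/
theorem marginals_eq [DecidableEq B] {η : ι → Finset A} {p : ι → A → ℝ} (hp : p ∈ closedCell η)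
    (k : κ) (b : B) :
    D.marginals p k b = ∑ a ∈ η (D.r k), if D.π k a = b then p (D.r k) a else 0 := by
  rw [marginals, finsum_eq_sum_of_support_subset (s := η (D.r k))]
  · exact Finset.sum_congr rfl fun _ _ => by congr
  · intro a ha
    by_contra h
    simp [(hp _).2.1 a h] at ha

theorem mapsTo_marginals (η : X.Face) :
    Set.MapsTo D.marginals (closedCell η.1) (closedCell (D.l η).1) := by
  classical
  intro p hp k
  refine ⟨fun b => ?_, fun b hb => ?_, ?_⟩
  · rw [D.marginals_eq hp]
    refine Finset.sum_nonneg fun a _ => ?_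
    split_ifs
    exacts [(hp _).1 a, le_rfl]
  · rw [D.marginals_eq hp]
    refine Finset.sum_eq_zero fun a ha => if_neg ?_
    rintro rfl
    exact hb ((D.mem_l _ _ _).2 ⟨a, ha, rfl⟩)
  · rw [← (hp (D.r k)).2.2]
    simp_rw [D.marginals_eq hp]
    rw [Finset.sum_comm]
    refine Finset.sum_congr rfl fun a ha => ?_
    rw [Finset.sum_ite_eq, if_pos ((D.mem_l _ _ _).2 ⟨a, ha, rfl⟩)]

theorem continuousOn_marginals (η : X.Face) : ContinuousOn D.marginals (closedCell η.1) := by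
  classical
  have : Set.EqOn D.marginals
      (fun p k b => ∑ a ∈ η.1 (D.r k), if D.π k a = b then p (D.r k) a else 0)
      (closedCell η.1) := fun p hp => funext fun k => funext fun b => D.marginals_eq hp k b
  refine ContinuousOn.congr (Continuous.continuousOn ?_) this
  refine continuous_pi fun k => continuous_pi fun b => continuous_finsetSum _ fun a _ => ?_
  split_ifs <;> fun_prop

variable [∀ x, Fintype {k // D.r k = x}]

/-- The product distributions. -/
def products (q : κ → B → ℝ) (x : ι) (a : A) : ℝ :=
  ∏ k : {k // D.r k = x}, q k (D.π k a)

theorem continuous_products : Continuous D.products :=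
  continuous_pi fun x => continuous_pi fun a => continuous_finsetProd _ fun k _ => by fun_prop

/-- Distributivity of products over sums: by `ext` and `exists_eq`, the projections identify the
factor of `u θ` at `x` with the product of the factors of `θ` over the fibre of `x`. -/
theorem sum_u_prod (θ : Y.Face) (x : ι) (g : {k // D.r k = x} → B → ℝ) :
    ∑ a ∈ (D.u θ).1 x, ∏ k, g k (D.π k a) = ∏ k, ∑ b ∈ θ.1 k.1, g k b := by
  classical
  rw [Finset.prod_univ_sum]
  refine Finset.sum_bij (fun a _ k => D.π k a) ?_ ?_ ?_ fun _ _ => rfl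
  · intro a ha
    exact Fintype.mem_piFinset.2 fun k => (D.mem_u _ _ _).1 ha k k.2
  · intro a _ a' _ h
    exact D.ext x a a' fun k hk => congrFun h ⟨k, hk⟩
  · intro b hb
    rw [Fintype.mem_piFinset] at hb
    -- `exists_eq` asks for a section over all of `κ`; the values of `c` off the fibre are
    -- arbitrary.
    choose c hc using Y.nonempty θ.1 θ.2
    obtain ⟨a, ha⟩ := D.exists_eq θ x (fun k => if h : D.r k = x then b ⟨k, h⟩ else c k)
      fun k => by
        split_ifs with h
        exacts [hb ⟨k, h⟩, hc k]
    have ha' : ∀ k (h : D.r k = x), D.π k a = b ⟨k, h⟩ := fun k h => by rw [ha k h, dif_pos h]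
    exact ⟨a, (D.mem_u _ _ _).2 fun k h => ha' k h ▸ hb ⟨k, h⟩, funext fun k => ha' k k.2⟩

theorem mapsTo_products (θ : Y.Face) :
    Set.MapsTo D.products (closedCell θ.1) (closedCell (D.u θ).1) := by
  intro q hq x
  refine ⟨fun a => Finset.prod_nonneg fun k _ => (hq _).1 _, fun a ha => ?_, ?_⟩
  · rw [D.mem_u] at ha
    push Not at ha
    obtain ⟨k, hk, h⟩ := ha
    exact Finset.prod_eq_zero (Finset.mem_univ (⟨k, hk⟩ : {k // D.r k = x})) ((hq k).2.1 _ h)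
  · simp only [products]
    rw [D.sum_u_prod θ x fun k => q k]
    exact Finset.prod_eq_one fun k _ => (hq k).2.2

theorem marginals_products {θ : Y.Face} {q : κ → B → ℝ} (hq : q ∈ closedCell θ.1) :
    D.marginals (D.products q) = q := by
  classical
  funext k b
  rw [D.marginals_eq (D.mapsTo_products θ hq)]
  -- Weighting the factor at `k` with the indicator of `b` makes the sum over `u θ` the marginal at
  -- `b`; all other factors then sum to one.
  have h := D.sum_u_prod θ (D.r k) fun k' b' =>
    q k' b' * if k' = ⟨k, rfl⟩ then (if b' = b then 1 else 0) else 1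
  simp only [Finset.prod_mul_distrib, Finset.prod_ite_eq', Finset.mem_univ, if_true] at h
  calc _ = _ := Finset.sum_congr rfl fun a _ => by
        rw [products, mul_ite, mul_one, mul_zero]
    _ = _ := h
    _ = q k b := by
      rw [Fintype.prod_eq_single (⟨k, rfl⟩ : {k' // D.r k' = D.r k})]
      · simp only [if_true, mul_ite, mul_one, mul_zero, Finset.sum_ite_eq']
        split_ifs with hb
        exacts [rfl, ((hq k).2.1 b hb).symm]
      · intro k' hk'
        simp only [hk', if_false, mul_one]
        exact (hq k').2.2

include D in
theorem homotopyEquivalent : X.HomotopyEquivalent Y := by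
  let F := realizationMap D.marginals D.l D.mapsTo_marginals D.continuousOn_marginals
  let F' := realizationMap D.products D.u D.mapsTo_products
    fun _ => D.continuous_products.continuousOn
  refine ⟨⟨F, F', ?_, ?_⟩⟩
  · refine homotopic_id_of_common_cell _ fun η => ⟨D.u (D.l η), fun p hp => ⟨?_, ?_⟩⟩
    · exact closedCell_mono (D.gc.le_u_l η) hp
    · exact D.mapsTo_products _ (D.mapsTo_marginals η hp)
  · have : F.comp F' = ContinuousMap.id _ := by
      ext1 q
      obtain ⟨θ, hθ, hq⟩ := q.2
      exact Subtype.ext (D.marginals_products (θ := ⟨θ, hθ⟩) hq)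
    rw [this]

end ProductDecomposition

end ProdsimplicialComplex
end

/-! ### Barycentric subdivision: existence and uniqueness of weights on a chain of cells. -/

noncomputable section

namespace ProdsimplicialComplex

variable {ι A : Type*}

instance (X : ProdsimplicialComplex ι A) : T2Space X.Realization :=
  T2Space.of_injective_continuous Subtype.val_injective X.continuous_coord

theorem isCompact_closedCell (η : ι → Finset A) : IsCompact (closedCell η) := by
  refine (isCompact_univ_pi fun _ => isCompact_univ_pi fun _ =>
    isCompact_Icc (a := (0 : ℝ)) (b := 1)).of_isClosed_subset ?_ ?_
  · simp only [closedCell, Set.ofPred_forall, Set.ofPred_and]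
    refine isClosed_iInter fun i => (isClosed_iInter fun a => ?_).inter
      ((isClosed_iInter fun a => isClosed_iInter fun _ => ?_).inter ?_)
    · exact isClosed_le continuous_const (by fun_prop)
    · exact isClosed_eq (by fun_prop) continuous_const
    · exact isClosed_eq (by fun_prop) continuous_const
  · intro p hp i _ a _
    refine ⟨(hp i).1 a, ?_⟩
    by_cases ha : a ∈ η i
    · rw [← (hp i).2.2]
      exact Finset.single_le_sum (f := p i) (fun b _ => (hp i).1 b) ha
    · rw [(hp i).2.1 a ha]
      exact zero_le_one

theorem compactSpace_realization (X : ProdsimplicialComplex ι A) [Finite X.Face] :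
    CompactSpace X.Realization := by
  have : ∀ η : X.Face, CompactSpace (closedCell η.1) := fun η =>
    isCompact_iff_compactSpace.1 (isCompact_closedCell η.1)
  refine ⟨?_⟩
  convert isCompact_iUnion fun η : X.Face => isCompact_range (X.continuous_cellInclusion η)
  refine (Set.eq_univ_of_forall fun p => ?_).symm
  obtain ⟨η, hη, hp⟩ := p.2
  exact Set.mem_iUnion.2 ⟨⟨η, hη⟩, ⟨p.1, hp⟩, rfl⟩

/-- The barycentre of a cell. -/
def barycentre (η : ι → Finset A) (i : ι) : A → ℝ :=
  Set.indicator (η i) fun _ => ((η i).card : ℝ)⁻¹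

theorem barycentre_of_mem {η : ι → Finset A} {i : ι} {a : A} (h : a ∈ η i) :
    barycentre η i a = ((η i).card : ℝ)⁻¹ :=
  Set.indicator_of_mem (Finset.mem_coe.2 h) _

theorem barycentre_of_notMem {η : ι → Finset A} {i : ι} {a : A} (h : a ∉ η i) :
    barycentre η i a = 0 :=
  Set.indicator_of_notMem (fun h' => h (Finset.mem_coe.1 h')) _

theorem barycentre_nonneg (η : ι → Finset A) (i : ι) (a : A) : 0 ≤ barycentre η i a :=
  Set.indicator_nonneg (fun _ _ => by positivity) _

variable {X : ProdsimplicialComplex ι A}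

theorem barycentre_ne_zero_iff (η : X.Face) (i : ι) (a : A) :
    barycentre η.1 i a ≠ 0 ↔ a ∈ η.1 i := by
  by_cases h : a ∈ η.1 i
  · simp [h, barycentre_of_mem h, (X.nonempty _ η.2 i).ne_empty]
  · simp [h, barycentre_of_notMem h]

theorem sum_barycentre (η : X.Face) (i : ι) : ∑ a ∈ η.1 i, barycentre η.1 i a = 1 := by
  rw [Finset.sum_congr rfl fun a ha => barycentre_of_mem ha, Finset.sum_const, nsmul_eq_mul,
    mul_inv_cancel₀]
  exact_mod_cast (X.nonempty _ η.2 i).card_pos.ne'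

theorem barycentre_mem_closedCell {η θ : X.Face} (h : η ≤ θ) :
    barycentre η.1 ∈ closedCell θ.1 :=
  closedCell_mono h fun i => ⟨barycentre_nonneg _ i, fun _ => barycentre_of_notMem,
    sum_barycentre η i⟩

variable [Fintype X.Face]

theorem sum_smul_barycentre_mem_closedCell {θ : X.Face} {w : X.Face → ℝ} (hw : ∀ η, 0 ≤ w η)
    (hle : ∀ η, w η ≠ 0 → η ≤ θ) (hsum : ∑ η, w η = 1) :
    ∑ η, w η • barycentre η.1 ∈ closedCell θ.1 := by
  rw [← Finset.sum_filter_ne_zero] at hsum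
  rw [← Finset.sum_filter_of_ne (p := fun η => w η ≠ 0) fun η _ h h' => h (by simp [h'])]
  exact (convex_closedCell θ.1).sum_mem (fun η _ => hw η) hsum fun η hη =>
    barycentre_mem_closedCell (hle η (Finset.mem_filter.1 hη).2)

/-- Every point in the cone over a closed cell is a combination of the barycentres of a chain of
faces. -/
theorem exists_chain_weights (θ : X.Face) (c : ℝ) (hc : 0 ≤ c) (p : ι → A → ℝ)
    (hp : ∀ i, (∀ a, 0 ≤ p i a) ∧ (∀ a, a ∉ θ.1 i → p i a = 0) ∧ ∑ a ∈ θ.1 i, p i a = c) :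
    ∃ w : X.Face → ℝ, (∀ η, 0 ≤ w η) ∧ IsChain (· ≤ ·) {η | w η ≠ 0} ∧
      (∀ η, w η ≠ 0 → η ≤ θ) ∧ ∑ η, w η = c ∧ ∑ η, w η • barycentre η.1 = p := by
  classical
  induction θ using WellFoundedLT.induction generalizing c p with
  | _ θ ih =>
  -- If a coordinate vanishes at a vertex of `θ` and `c > 0`, the support of `p` is a proper face,
  -- to which induction applies. The rest of the proof subtracts the largest multiple of the
  -- barycentre of `θ` that keeps the coordinates nonnegative; this reaches the present case.
  have key : ∀ (c : ℝ) (p : ι → A → ℝ), 0 ≤ c →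
      (∀ i, (∀ a, 0 ≤ p i a) ∧ (∀ a, a ∉ θ.1 i → p i a = 0) ∧ ∑ a ∈ θ.1 i, p i a = c) →
      (c = 0 ∨ ∃ i, ∃ a ∈ θ.1 i, p i a = 0) →
      ∃ w : X.Face → ℝ, (∀ η, 0 ≤ w η) ∧ IsChain (· ≤ ·) {η | w η ≠ 0} ∧
        (∀ η, w η ≠ 0 → η < θ) ∧ ∑ η, w η = c ∧ ∑ η, w η • barycentre η.1 = p := by
    intro c p hc hp h
    rcases hc.eq_or_lt with rfl | hc
    · refine ⟨0, fun _ => le_rfl, by simp, by simp, by simp, ?_⟩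
      ext i a
      by_cases ha : a ∈ θ.1 i
      · simpa using ((Finset.sum_eq_zero_iff_of_nonneg fun a _ => (hp i).1 a).1 (hp i).2.2 a ha).symm
      · simpa using ((hp i).2.1 a ha).symm
    · obtain ⟨i₀, a₀, ha₀, h₀⟩ := h.resolve_left hc.ne'
      have hsub : ∀ i, {a ∈ θ.1 i | p i a ≠ 0} ⊆ θ.1 i := fun i => Finset.filter_subset _ _
      have hmem : (fun i => {a ∈ θ.1 i | p i a ≠ 0}) ∈ X.cells := by
        refine X.down_closed _ θ.2 _ (fun i => ?_) hsub
        by_contra hne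
        rw [Finset.not_nonempty_iff_eq_empty, Finset.filter_eq_empty_iff] at hne
        exact hc.ne ((hp i).2.2 ▸ (Finset.sum_eq_zero fun a ha => not_not.1 (hne ha)).symm)
      have hlt : (⟨_, hmem⟩ : X.Face) < θ := by
        refine lt_of_le_not_ge hsub fun h => ?_
        exact (Finset.mem_filter.1 (h i₀ ha₀)).2 h₀
      obtain ⟨w, h1, h2, h3, h4, h5⟩ := ih _ hlt c hc.le p fun i => ⟨(hp i).1, fun a ha => by
        by_contra h'
        exact ha (Finset.mem_filter.2 ⟨by_contra fun h'' => h' ((hp i).2.1 a h''), h'⟩), by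
        rw [Finset.sum_filter_ne_zero, (hp i).2.2]⟩
      exact ⟨w, h1, h2, fun η hη => (h3 η hη).trans_lt hlt, h4, h5⟩
  -- The upper bounds on the multiple `t`: nonnegativity at `a` means `t ≤ p i a * (θ.1 i).card`.
  -- Every one-vertex factor gives the bound `c`, so `T` is finite even if `ι` is infinite;
  -- inserting `c` keeps `T` nonempty if `ι` is empty.
  let T : Set ℝ := insert c {t | ∃ i, ∃ a ∈ θ.1 i, t = p i a * (θ.1 i).card}
  have hT : T.Finite := by
    have h1 : (⋃ i ∈ {i | 1 < (θ.1 i).card}, (fun a => p i a * (θ.1 i).card) '' θ.1 i).Finite :=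
      (X.finite_dim _ θ.2).biUnion fun i _ => (θ.1 i).finite_toSet.image _
    refine ((Set.finite_singleton c).union h1).subset ?_
    rintro t (rfl | ⟨i, a, ha, rfl⟩)
    · exact Or.inl rfl
    · by_cases hi : 1 < (θ.1 i).card
      · exact Or.inr (Set.mem_biUnion hi ⟨a, ha, rfl⟩)
      · have h1 : (θ.1 i).card = 1 :=
          le_antisymm (not_lt.1 hi) (X.nonempty _ θ.2 i).card_pos
        obtain ⟨b, hb⟩ := Finset.card_eq_one.1 h1
        rw [hb, Finset.mem_singleton] at ha
        subst ha
        left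
        rw [h1, ← (hp i).2.2, hb]
        simp
  obtain ⟨t, htT, hmin⟩ := hT.exists_minimal ⟨c, Set.mem_insert _ _⟩
  replace hmin : ∀ s ∈ T, t ≤ s := fun s hs => (le_total t s).elim id fun h => hmin hs h
  have ht0 : 0 ≤ t := by
    rcases htT with rfl | ⟨i, a, -, rfl⟩
    · exact hc
    · exact mul_nonneg ((hp i).1 a) (Nat.cast_nonneg _)
  have htc : t ≤ c := hmin c (Set.mem_insert _ _)
  have hcard : ∀ i, (0 : ℝ) < (θ.1 i).card := fun i => by
    exact_mod_cast (X.nonempty _ θ.2 i).card_pos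
  have hkey := key (c - t) (p - t • barycentre θ.1) (by linarith)
    (fun i => ⟨fun a => ?_, fun a ha => ?_, ?_⟩) ?_
  · obtain ⟨w, h1, h2, h3, h4, h5⟩ := hkey
    have hwθ : w θ = 0 := by_contra fun h => (h3 θ h).false
    refine ⟨w + Pi.single θ t, fun η => ?_, ?_, fun η hη => ?_, ?_, ?_⟩
    · have hs : (0 : X.Face → ℝ) ≤ Pi.single θ t := Pi.single_nonneg.2 ht0
      exact add_nonneg (h1 η) (hs η)
    · refine (h2.insert (a := θ) fun η hη _ => Or.inr (h3 η hη).le).mono fun η hη => ?_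
      rcases eq_or_ne η θ with rfl | hne
      · exact Or.inl rfl
      · right
        simpa [hne] using hη
    · rcases eq_or_ne η θ with rfl | hne
      · exact le_rfl
      · exact (h3 η (by simpa [hne] using hη)).le
    · simp [Finset.sum_add_distrib, h4]
    · simp only [Pi.add_apply, add_smul, Finset.sum_add_distrib, h5]
      rw [Finset.sum_eq_single θ (fun η _ hne => by simp [hne]) (by simp)]
      simp
  · by_cases ha : a ∈ θ.1 i
    · have := hmin _ (Or.inr ⟨i, a, ha, rfl⟩)
      simp only [Pi.sub_apply, Pi.smul_apply, smul_eq_mul, barycentre_of_mem ha, sub_nonneg]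
      rwa [← div_eq_mul_inv, div_le_iff₀ (hcard i)]
    · simp [barycentre_of_notMem ha, (hp i).1 a]
  · simp [barycentre_of_notMem ha, (hp i).2.1 a ha]
  · simp only [Pi.sub_apply, Pi.smul_apply, smul_eq_mul, Finset.sum_sub_distrib, (hp i).2.2,
      ← Finset.mul_sum, sum_barycentre, mul_one]
  · rcases htT with rfl | ⟨i, a, ha, hta⟩
    · left
      exact sub_self _
    · right
      refine ⟨i, a, ha, ?_⟩
      simp only [Pi.sub_apply, Pi.smul_apply, smul_eq_mul, barycentre_of_mem ha, hta]
      rw [mul_inv_cancel_right₀ (hcard i).ne', sub_self]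

theorem exists_isGreatest_support {P : Type*} [PartialOrder P] [Finite P] {w : P → ℝ}
    (hch : IsChain (· ≤ ·) {η | w η ≠ 0}) (hw : w ≠ 0) :
    ∃ m, IsGreatest {η | w η ≠ 0} m := by
  obtain ⟨m, hm⟩ := (Set.toFinite {η | w η ≠ 0}).exists_maximal (Function.ne_iff.1 hw)
  exact ⟨m, hm.1, fun η hη => (hch.total hη hm.1).elim id fun h => hm.2 hη h⟩

/-- Nothing cancels among nonnegative terms, so the support of the point is the top cell of the
chain. The point thus determines that cell. -/
theorem sum_smul_barycentre_ne_zero_iff {w : X.Face → ℝ} (hw : ∀ η, 0 ≤ w η) {m : X.Face}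
    (hm : IsGreatest {η | w η ≠ 0} m) (i : ι) (a : A) :
    (∑ η, w η • barycentre η.1) i a ≠ 0 ↔ a ∈ m.1 i := by
  simp only [Finset.sum_apply, Pi.smul_apply, smul_eq_mul]
  rw [Ne, Finset.sum_eq_zero_iff_of_nonneg fun η _ =>
    mul_nonneg (hw η) (barycentre_nonneg _ _ _)]
  push Not
  constructor
  · rintro ⟨η, -, h⟩
    exact hm.2 (left_ne_zero_of_mul h) i
      ((barycentre_ne_zero_iff η i a).1 (right_ne_zero_of_mul h))
  · exact fun h => ⟨m, Finset.mem_univ _, mul_ne_zero hm.1 ((barycentre_ne_zero_iff m i a).2 h)⟩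

/-- Both chains have the same top cell `m`. Subtracting the smaller of the two weights at `m` from
both removes `m` from one support and enlarges neither, so induction on the total size of the
supports applies. -/
theorem chain_weights_unique {w w' : X.Face → ℝ} (hw : ∀ η, 0 ≤ w η) (hw' : ∀ η, 0 ≤ w' η)
    (hch : IsChain (· ≤ ·) {η | w η ≠ 0}) (hch' : IsChain (· ≤ ·) {η | w' η ≠ 0})
    (hsum : ∑ η, w η = ∑ η, w' η)
    (hbary : ∑ η, w η • barycentre η.1 = ∑ η, w' η • barycentre η.1) : w = w' := by
  classical
  induction hn : {η | w η ≠ 0}.ncard + {η | w' η ≠ 0}.ncard using Nat.strong_induction_on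
    generalizing w w' with
  | _ n ih =>
  by_cases h0 : w = 0
  · subst h0
    simp only [Pi.zero_apply, Finset.sum_const_zero] at hsum
    funext η
    exact ((Finset.sum_eq_zero_iff_of_nonneg fun η _ => hw' η).1 hsum.symm η
      (Finset.mem_univ η)).symm
  by_cases h0' : w' = 0
  · subst h0'
    simp only [Pi.zero_apply, Finset.sum_const_zero] at hsum
    funext η
    exact (Finset.sum_eq_zero_iff_of_nonneg fun η _ => hw η).1 hsum η (Finset.mem_univ η)
  obtain ⟨m, hm⟩ := exists_isGreatest_support hch h0
  obtain ⟨m', hm'⟩ := exists_isGreatest_support hch' h0'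
  obtain rfl : m = m' := by
    refine Subtype.ext (funext fun i => Finset.ext fun a => ?_)
    rw [← sum_smul_barycentre_ne_zero_iff hw hm, ← sum_smul_barycentre_ne_zero_iff hw' hm', hbary]
  wlog hle : w m ≤ w' m generalizing w w'
  · exact (this hw' hw hch' hch hsum.symm hbary.symm (by rw [add_comm, hn]) h0' h0 hm' hm
      (le_of_not_ge hle)).symm
  have hsub : ∀ v : X.Face → ℝ, v m ≠ 0 →
      {η | (v - Pi.single m (w m) : X.Face → ℝ) η ≠ 0} ⊆ {η | v η ≠ 0} := by
    intro v hv η hη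
    rcases eq_or_ne η m with rfl | hne
    · exact hv
    · simpa [hne] using hη
  have hnonneg : ∀ v : X.Face → ℝ, (∀ η, 0 ≤ v η) → w m ≤ v m →
      ∀ η, 0 ≤ (v - Pi.single m (w m) : X.Face → ℝ) η := by
    intro v hv h η
    rcases eq_or_ne η m with rfl | hne
    · simpa using h
    · simpa [hne] using hv η
  have hlt : {η | (w - Pi.single m (w m) : X.Face → ℝ) η ≠ 0}.ncard < {η | w η ≠ 0}.ncard := by
    refine Set.ncard_lt_ncard ⟨hsub w hm.1, fun h => ?_⟩ (Set.toFinite _)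
    simpa using h hm.1
  have := ih _ ?_ (hnonneg w hw le_rfl) (hnonneg w' hw' hle) (hch.mono (hsub w hm.1))
    (hch'.mono (hsub w' hm'.1)) ?_ ?_ rfl
  · exact sub_left_injective this
  · rw [← hn]
    exact add_lt_add_of_lt_of_le hlt (Set.ncard_le_ncard (hsub w' hm'.1) (Set.toFinite _))
  · simp only [Pi.sub_apply, Finset.sum_sub_distrib, hsum]
  · simp only [Pi.sub_apply, sub_smul, Finset.sum_sub_distrib, hbary]

end ProdsimplicialComplex
end

noncomputable section

open ProdsimplicialComplex

namespace PreAbstractSimplicialComplex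

variable {V ι A : Type*} {X : ProdsimplicialComplex ι A}

/-- The weights on the faces of `X` given by a point of the order complex. -/
theorem weights_of_mem_closedCell [Fintype X.Face] (j : X.Face ↪ V) {p : Unit → V → ℝ}
    {s : Unit → Finset V} (hs : s () ∈ ((orderComplex X.Face).image j).faces)
    (hp : p ∈ closedCell s) :
    IsChain (· ≤ ·) {η | p () (j η) ≠ 0} ∧ (∀ v, v ∉ Set.range j → p () v = 0) ∧
      ∑ η, p () (j η) = 1 := by
  obtain ⟨t, ⟨-, hch⟩, hts⟩ := mem_faces_image.1 hs
  have hsupp : ∀ η, p () (j η) ≠ 0 → η ∈ t := fun η h => by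
    by_contra hη
    exact h ((hp ()).2.1 _ (by rwa [← hts, Finset.mem_map']))
  refine ⟨hch.mono hsupp, fun v hv => (hp ()).2.1 _ fun h => ?_, ?_⟩
  · obtain ⟨η, -, rfl⟩ := Finset.mem_map.1 (hts ▸ h)
    exact hv ⟨η, rfl⟩
  · rw [← (hp ()).2.2, ← hts, Finset.sum_map]
    exact (Finset.sum_subset (Finset.subset_univ t) fun η _ h => by_contra fun h' =>
      h (hsupp η h')).symm

/-- The barycentric subdivision is a subdivision. -/
theorem isSubdivision_image_Bd [Finite X.Face] (j : X.Face ↪ V) :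
    (X.Bd.image j).IsSubdivision X := by
  classical
  have := Fintype.ofFinite X.Face
  let S := (orderComplex X.Face).image j
  have hS : Finite S.toProdsimplicial.Face := by
    refine Set.Finite.to_subtype (Set.Finite.of_injOn (f := fun s : Unit → Finset V => s ())
      (fun s hs => hs) (fun s _ s' _ h => funext fun _ => h)
      (finite_faces_image (finite_faces_orderComplex X.Face) j))
  have hnn : ∀ (p : S.toProdsimplicial.Realization) v, 0 ≤ p.1 () v := fun p v => by
    obtain ⟨s, -, hp⟩ := p.2
    exact (hp ()).1 v
  have hcell : ∀ s ∈ S.toProdsimplicial.cells, ∃ θ : X.Face, ∀ p ∈ closedCell s,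
      ∑ η, p () (j η) • barycentre η.1 ∈ closedCell θ.1 := by
    intro s hs
    obtain ⟨t, ⟨hne, hch⟩, hts⟩ := mem_faces_image.1 hs
    obtain ⟨m, hm⟩ := t.exists_maximal hne
    refine ⟨m, fun p hp => sum_smul_barycentre_mem_closedCell (fun η => (hp ()).1 _) ?_
      (weights_of_mem_closedCell j hs hp).2.2⟩
    intro η h
    have hη : η ∈ t := by
      by_contra hη
      exact h ((hp ()).2.1 _ (by rwa [← hts, Finset.mem_map']))
    exact (hch.total hη hm.1).elim id fun h' => hm.2 hη h'
  choose φ hφ using hcell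
  let h : C(S.toProdsimplicial.Realization, X.Realization) :=
    realizationMap (fun p => ∑ η, p () (j η) • barycentre η.1) (fun s => φ s.1 s.2)
      (fun s p hp => hφ s.1 s.2 p hp) fun s => Continuous.continuousOn (by fun_prop)
  have hinj : Function.Injective h := by
    intro p q hpq
    obtain ⟨s, hs, hp⟩ := p.2
    obtain ⟨s', hs', hq⟩ := q.2
    obtain ⟨h1, h2, h3⟩ := weights_of_mem_closedCell j hs hp
    obtain ⟨h1', h2', h3'⟩ := weights_of_mem_closedCell j hs' hq
    have heq := chain_weights_unique (fun η => hnn p (j η)) (fun η => hnn q (j η)) h1 h1'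
      (h3.trans h3'.symm) (congrArg Subtype.val hpq)
    refine Subtype.ext (funext fun _ => funext fun v => ?_)
    by_cases hv : v ∈ Set.range j
    · obtain ⟨η, rfl⟩ := hv
      exact congrFun heq η
    · exact (h2 v hv).trans (h2' v hv).symm
  have hsurj : Function.Surjective h := by
    intro x
    obtain ⟨θ, hθ, hx⟩ := x.2
    obtain ⟨w, h1, h2, -, h4, h5⟩ := exists_chain_weights ⟨θ, hθ⟩ 1 zero_le_one x.1 hx
    have hext : ∀ η, Function.extend j w 0 (j η) = w η := j.injective.extend_apply w 0
    have hext' : ∀ v, (¬∃ η, j η = v) → Function.extend j w 0 v = 0 := fun v hv => by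
      rw [Function.extend_apply' _ _ _ hv, Pi.zero_apply]
    have hne : ({η | w η ≠ 0} : Finset X.Face).Nonempty := by
      rw [Finset.nonempty_iff_ne_empty, Ne, Finset.filter_eq_empty_iff]
      intro h
      simp only [Finset.mem_univ, forall_true_left, not_not] at h
      simp [h] at h4
    have hmem : (fun _ => Function.extend j w 0) ∈
        closedCell (fun _ : Unit => ({η | w η ≠ 0} : Finset X.Face).map j) := by
      refine fun _ => ⟨fun v => ?_, fun v hv => ?_, ?_⟩
      · by_cases hv : ∃ η, j η = v
        · obtain ⟨η, rfl⟩ := hv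
          exact (h1 η).trans_eq (hext η).symm
        · exact (hext' v hv).ge
      · by_cases hv' : ∃ η, j η = v
        · obtain ⟨η, rfl⟩ := hv'
          simpa [hext] using hv
        · exact hext' v hv'
      · rw [Finset.sum_map]
        simp only [hext]
        rw [Finset.sum_filter_ne_zero, h4]
    refine ⟨⟨fun _ => Function.extend j w 0, _, ?_, hmem⟩, Subtype.ext ?_⟩
    · exact mem_faces_image.2 ⟨_, ⟨hne, by simpa using h2⟩, rfl⟩
    · change ∑ η, Function.extend j w 0 (j η) • barycentre η.1 = x.1
      simpa only [hext] using h5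
  -- A continuous bijection from a compact space to a Hausdorff space is a homeomorphism, so
  -- continuity of the inverse needs no argument.
  have : CompactSpace (X.Bd.image j).toProdsimplicial.Realization :=
    S.toProdsimplicial.compactSpace_realization
  refine ⟨Continuous.homeoOfEquivCompactToT2 (f := Equiv.ofBijective h ⟨hinj, hsurj⟩)
    h.continuous, fun s hs => ⟨⟨_, (φ s hs).2, fun p hp => hφ s hs p.1 hp⟩, ?_⟩⟩
  intro p q r t _ _ _ hr
  change ∑ η, r.1 () (j η) • barycentre η.1 =
    (1 - t) • ∑ η, p.1 () (j η) • barycentre η.1 + t • ∑ η, q.1 () (j η) • barycentre η.1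
  simp only [hr, Finset.smul_sum, ← Finset.sum_add_distrib, Pi.add_apply, Pi.smul_apply,
    smul_smul, smul_eq_mul, add_smul]

end PreAbstractSimplicialComplex
end

/-! ### Simple homotopy equivalence from a product decomposition; face posets of products. -/

noncomputable section

open PreAbstractSimplicialComplex

namespace ProdsimplicialComplex

variable {ι κ A B : Type*} {X : ProdsimplicialComplex ι A} {Y : ProdsimplicialComplex κ B}

theorem SimpleHomotopyEquivalent.symm (h : X.SimpleHomotopyEquivalent Y) :
    Y.SimpleHomotopyEquivalent X :=
  let ⟨S, T, hS, hT, hSX, hTY, hST⟩ := h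
  ⟨T, S, hT, hS, hTY, hSX, Relation.EqvGen.symm _ _ hST⟩

/-- The common subdivision data are the barycentric subdivision of `X` and, inside it, the copy of
that of `Y` onto which it collapses; numbering the faces of `X` moves both to vertices in `ℕ`. -/
theorem ProductDecomposition.simpleHomotopyEquivalent (D : ProductDecomposition X Y)
    [Finite X.Face] : X.SimpleHomotopyEquivalent Y := by
  have : Finite Y.Face := Finite.of_injective _ D.embedding.injective
  obtain ⟨n, ⟨f⟩⟩ := Finite.exists_equiv_fin X.Face
  have i : X.Face ↪ ℕ := f.toEmbedding.trans Fin.valEmbedding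
  refine ⟨X.Bd.image i, Y.Bd.image (D.embedding.toEmbedding.trans i),
    finite_faces_image (finite_faces_orderComplex _) _,
    finite_faces_image (finite_faces_orderComplex _) _,
    isSubdivision_image_Bd _, isSubdivision_image_Bd _, ?_⟩
  rw [← image_image]
  exact (D.collapsesOnto.image i).formalDeformation

/-- The face poset of a product. -/
def faceProd (X : ProdsimplicialComplex ι A) (Y : ProdsimplicialComplex κ B) :
    X.Face × Y.Face ≃o (X.prod Y).Face where
  toEquiv := Equiv.ofBijective
    (fun p => ⟨_, p.1.1, p.1.2, p.2.1, p.2.2, rfl⟩) <| by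
      constructor
      · rintro ⟨η, θ⟩ ⟨η', θ'⟩ h
        have h' := congrArg Subtype.val h
        refine Prod.ext (Subtype.ext (funext fun i => ?_)) (Subtype.ext (funext fun j => ?_))
        · exact Finset.map_injective _ (congrFun h' (Sum.inl i))
        · exact Finset.map_injective _ (congrFun h' (Sum.inr j))
      · rintro ⟨_, η, hη, θ, hθ, rfl⟩
        exact ⟨(⟨η, hη⟩, ⟨θ, hθ⟩), rfl⟩
  map_rel_iff' := by
    rintro ⟨η, θ⟩ ⟨η', θ'⟩
    constructor
    · exact fun h => ⟨fun i => Finset.map_subset_map.1 (h (Sum.inl i)),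
        fun j => Finset.map_subset_map.1 (h (Sum.inr j))⟩
    · rintro ⟨h, h'⟩ (i | j)
      · exact Finset.map_subset_map.2 (h i)
      · exact Finset.map_subset_map.2 (h' j)

theorem faceProd_apply (p : X.Face × Y.Face) :
    (faceProd X Y p).1 = Sum.elim (fun i => (p.1.1 i).map Function.Embedding.inl)
      (fun j => (p.2.1 j).map Function.Embedding.inr) :=
  rfl

end ProdsimplicialComplex

namespace PreAbstractSimplicialComplex

theorem orderComplex_image {P Q : Type*} [PartialOrder P] [PartialOrder Q] (e : P ≃o Q) :
    (orderComplex P).image e.toEquiv.toEmbedding = orderComplex Q := by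
  ext s
  rw [mem_faces_image]
  constructor
  · rintro ⟨t, ⟨ht, hch⟩, rfl⟩
    refine ⟨ht.map, ?_⟩
    rw [Finset.coe_map]
    exact hch.image_of_map_rel _ _ _ fun _ _ h => e.monotone h
  · rintro ⟨ht, hch⟩
    refine ⟨s.map e.symm.toEquiv.toEmbedding, ⟨ht.map, ?_⟩, ?_⟩
    · rw [Finset.coe_map]
      exact hch.image_of_map_rel _ _ _ fun _ _ h => e.symm.monotone h
    · rw [Finset.map_map]
      convert Finset.map_refl
      ext x
      simp

end PreAbstractSimplicialComplex

open ProdsimplicialComplex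

/-! ### The decompositions of the Hom complexes and of the clique complex. -/

variable {VG VH VK : Type*} (G : LoopGraph VG) (H : LoopGraph VH) (K : LoopGraph VK)

theorem finite_setOf_one_lt_card_of_image {ι κ A B : Type*} [DecidableEq B] (η : ι → Finset A)
    (r : κ → ι) (π : κ → A → B) (hr : ∀ i, (r ⁻¹' {i}).Finite)
    (h : {i | 1 < (η i).card}.Finite) :
    {k | 1 < ((η (r k)).image (π k)).card}.Finite := by
  refine (h.biUnion fun i _ => hr i).subset fun k hk => Set.mem_biUnion (x := r k) ?_ rfl
  exact lt_of_lt_of_le (show 1 < _ from hk) Finset.card_image_le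

open scoped Classical in
/-- The first projection of a cell of `Hom(G, H × K)`. -/
def homProdFst (η : (homComplex G (H.prod K)).Face) : (homComplex G H).Face :=
  ⟨fun x => (η.1 x).image Prod.fst, fun x => (η.2.1 x).image _,
    η.2.2.1.subset fun _ h => lt_of_lt_of_le h Finset.card_image_le, fun x y hxy a ha b hb => by
      obtain ⟨p, hp, rfl⟩ := Finset.mem_image.1 ha
      obtain ⟨q, hq, rfl⟩ := Finset.mem_image.1 hb
      exact (η.2.2.2 x y hxy p hp q hq).1⟩

open scoped Classical in
/-- The second projection of a cell of `Hom(G, H × K)`. -/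
def homProdSnd (η : (homComplex G (H.prod K)).Face) : (homComplex G K).Face :=
  ⟨fun x => (η.1 x).image Prod.snd, fun x => (η.2.1 x).image _,
    η.2.2.1.subset fun _ h => lt_of_lt_of_le h Finset.card_image_le, fun x y hxy a ha b hb => by
      obtain ⟨p, hp, rfl⟩ := Finset.mem_image.1 ha
      obtain ⟨q, hq, rfl⟩ := Finset.mem_image.1 hb
      exact (η.2.2.2 x y hxy p hp q hq).2⟩

/-- The cell `η × θ` of `Hom(G, H × K)`. -/
def homProdMk (p : (homComplex G H).Face × (homComplex G K).Face) :
    (homComplex G (H.prod K)).Face :=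
  ⟨fun x => p.1.1 x ×ˢ p.2.1 x, fun x => (p.1.2.1 x).product (p.2.2.1 x),
    (p.1.2.2.1.union p.2.2.2.1).subset fun x hx => by
      by_contra h
      simp only [Set.mem_union, Set.mem_ofPred_eq, not_or, not_lt] at h hx
      rw [Finset.card_product] at hx
      exact absurd (Nat.mul_le_mul h.1 h.2) (by lia),
    fun x y hxy a ha b hb => by
      rw [Finset.mem_product] at ha hb
      exact ⟨p.1.2.2.2 x y hxy _ ha.1 _ hb.1, p.2.2.2.2 x y hxy _ ha.2 _ hb.2⟩⟩

/-- The decomposition of `Hom(G, H × K)`. -/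
def homProdDecomposition :
    ProductDecomposition (homComplex G (H.prod K)) ((homComplex G H).prod (homComplex G K)) where
  r := Sum.elim id id
  π := Sum.elim (fun _ p => Sum.inl p.1) (fun _ p => Sum.inr p.2)
  l η := faceProd _ _ (homProdFst G H K η, homProdSnd G H K η)
  u θ := homProdMk G H K ((faceProd _ _).symm θ)
  mem_l := by
    rintro η (k | k) b
    · simp [faceProd_apply, homProdFst]
    · simp only [faceProd_apply, homProdSnd, Sum.elim_inr, Finset.mem_map, Finset.mem_image]
      constructor
      · rintro ⟨_, ⟨p, hp, rfl⟩, rfl⟩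
        exact ⟨p, hp, rfl⟩
      · rintro ⟨p, hp, rfl⟩
        exact ⟨_, ⟨p, hp, rfl⟩, rfl⟩
  mem_u θ x a := by
    obtain ⟨p, rfl⟩ := (faceProd _ _).surjective θ
    simp [faceProd_apply, homProdMk]
  ext x a a' h := Prod.ext (by simpa using h (Sum.inl x) rfl) (by simpa using h (Sum.inr x) rfl)
  exists_eq θ x b hb := by
    obtain ⟨p, rfl⟩ := (faceProd _ _).surjective θ
    obtain ⟨a, -, ha⟩ := Finset.mem_map.1 (hb (Sum.inl x))
    obtain ⟨a', -, ha'⟩ := Finset.mem_map.1 (hb (Sum.inr x))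
    refine ⟨(a, a'), ?_⟩
    rintro (k | k) rfl
    exacts [ha, ha']

/-- A family of finite sets, only finitely many of which have more than one element, has only
finitely many sections. -/
theorem finite_setOf_forall_mem {κ B : Type*} (η : κ → Finset B)
    (h : {v | 1 < (η v).card}.Finite) : {f : κ → B | ∀ v, f v ∈ η v}.Finite := by
  have := h.to_subtype
  refine Set.Finite.of_finite_image (f := fun f (v : {v | 1 < (η v).card}) => f v) ?_ ?_
  · refine (Set.Finite.pi' fun v : {v | 1 < (η v).card} => (η v).finite_toSet).subset ?_
    rintro _ ⟨f, hf, rfl⟩ v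
    exact hf v
  · intro f hf g hg hfg
    funext v
    by_cases hv : 1 < (η v).card
    · exact congrFun hfg ⟨v, hv⟩
    · exact Finset.card_le_one.1 (not_lt.1 hv) _ (hf v) _ (hg v)

open scoped Classical in
/-- The family of the sets of values of the members of a cell of `Hom(G, K ^ H)`. -/
def homPowerValues (η : (homComplex G (K.power H)).Face) (p : VG × VH) : Finset VK :=
  (η.1 p.1).image fun f => f p.2

theorem mem_homPowerValues {η : (homComplex G (K.power H)).Face} {p : VG × VH} {b : VK} :
    b ∈ homPowerValues G H K η p ↔ ∃ f ∈ η.1 p.1, f p.2 = b := by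
  simp [homPowerValues]

/-- The cell of `Hom(G × H, K)` given by a cell of `Hom(G, K ^ H)`. -/
def homPowerProj (hfin : ∀ η, {p | 1 < (homPowerValues G H K η p).card}.Finite)
    (η : (homComplex G (K.power H)).Face) : (homComplex (G.prod H) K).Face :=
  ⟨homPowerValues G H K η, fun p => by
    obtain ⟨f, hf⟩ := η.2.1 p.1
    exact ⟨_, (mem_homPowerValues G H K).2 ⟨f, hf, rfl⟩⟩, hfin η, fun p q hpq a ha b hb => by
    obtain ⟨f, hf, rfl⟩ := (mem_homPowerValues G H K).1 ha
    obtain ⟨g, hg, rfl⟩ := (mem_homPowerValues G H K).1 hb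
    exact η.2.2.2 _ _ hpq.1 f hf g hg _ _ hpq.2⟩

/-- The cell of `Hom(G, K ^ H)` given by a cell of `Hom(G × H, K)`. -/
def homPowerSections (η : (homComplex (G.prod H) K).Face) : (homComplex G (K.power H)).Face :=
  have hfin : ∀ x, {f : VH → VK | ∀ v, f v ∈ η.1 (x, v)}.Finite := fun x =>
    finite_setOf_forall_mem _ (Set.Finite.preimage (f := Prod.mk x)
      (Prod.mk_right_injective x).injOn η.2.2.1)
  ⟨fun x => (hfin x).toFinset, fun x => by
    choose f hf using fun v => η.2.1 (x, v)
    exact ⟨f, (hfin x).mem_toFinset.2 hf⟩,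
    (η.2.2.1.image Prod.fst).subset fun x hx => by
      -- Two distinct sections over `x` differ at some `v`, so `η (x, v)` has more than one element;
      -- only finitely many `x` allow this.
      obtain ⟨f, hf, g, hg, hne⟩ := Finset.one_lt_card.1 hx
      rw [Set.Finite.mem_toFinset] at hf hg
      obtain ⟨v, hv⟩ := Function.ne_iff.1 hne
      exact ⟨(x, v), Finset.one_lt_card.2 ⟨_, hf v, _, hg v, hv⟩, rfl⟩,
    fun x y hxy f hf g hg v w hvw => by
      rw [Set.Finite.mem_toFinset] at hf hg
      exact η.2.2.2 (x, v) (y, w) ⟨hxy, hvw⟩ _ (hf v) _ (hg w)⟩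

theorem mem_homPowerSections {η : (homComplex (G.prod H) K).Face} {x : VG} {f : VH → VK} :
    f ∈ (homPowerSections G H K η).1 x ↔ ∀ v, f v ∈ η.1 (x, v) := by
  simp [homPowerSections]

/-- The decomposition of `Hom(G, K ^ H)`. -/
def homPowerDecomposition (hfin : ∀ η, {p | 1 < (homPowerValues G H K η p).card}.Finite) :
    ProductDecomposition (homComplex G (K.power H)) (homComplex (G.prod H) K) where
  r := Prod.fst
  π p f := f p.2
  l := homPowerProj G H K hfin
  u := homPowerSections G H K
  mem_l _ _ _ := mem_homPowerValues G H K
  mem_u θ x f := by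
    rw [mem_homPowerSections]
    refine ⟨?_, fun h v => h (x, v) rfl⟩
    rintro h ⟨_, v⟩ rfl
    exact h v
  ext x f g h := funext fun v => h (x, v) rfl
  exists_eq θ x b hb := ⟨fun v => b (x, v), by
    rintro ⟨_, v⟩ rfl
    rfl⟩

/-- Supplies the hypothesis of `homPowerDecomposition` for finite `H`: over each of the finitely
many nontrivial factors of `η` lie only finitely many pairs. -/
theorem finite_homPowerValues [Finite VH] (η : (homComplex G (K.power H)).Face) :
    {p | 1 < (homPowerValues G H K η p).card}.Finite := by
  classical
  have hr : ∀ x, ((Prod.fst : VG × VH → VG) ⁻¹' {x}).Finite := fun x =>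
    (Set.finite_range (Prod.mk x)).subset fun p hp => ⟨p.2, Prod.ext hp.symm rfl⟩
  exact finite_setOf_one_lt_card_of_image η.1 _ (fun p f => f p.2) hr η.2.2.1

/-- If two members of a cell of `Hom(G, K ^ H)` differ at infinitely many vertices, then the complex
is infinite: each single value of one can be replaced by that of the other. -/
theorem finite_ne_of_finite_face [Finite (homComplex G (K.power H)).Face]
    (η : (homComplex G (K.power H)).Face) {x : VG} {f g : VH → VK} (hf : f ∈ η.1 x)
    (hg : g ∈ η.1 x) : {v | f v ≠ g v}.Finite := by
  classical
  have hmem : ∀ v, Function.update η.1 x {Function.update f v (g v)} ∈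
      (homComplex G (K.power H)).cells := by
    intro v
    -- Adjacency in `K ^ H` is tested on single values, so it survives when each value of a new
    -- member is taken by some member of `η` at the same place, possibly a different one for each
    -- `w`.
    have key : ∀ y, ∀ h ∈ Function.update η.1 x {Function.update f v (g v)} y, ∀ w,
        ∃ h' ∈ η.1 y, h w = h' w := by
      intro y h hh w
      rcases eq_or_ne y x with rfl | hy
      · rw [Function.update_self, Finset.mem_singleton] at hh
        subst hh
        rcases eq_or_ne w v with rfl | hw
        · exact ⟨g, hg, Function.update_self ..⟩
        · exact ⟨f, hf, Function.update_of_ne hw ..⟩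
      · rw [Function.update_of_ne hy] at hh
        exact ⟨h, hh, rfl⟩
    refine ⟨fun y => ?_, η.2.2.1.subset fun y hy => ?_, fun y z hyz h hh k hk w w' hw => ?_⟩
    · rcases eq_or_ne y x with rfl | hy
      · simp
      · simpa [hy] using η.2.1 y
    · rcases eq_or_ne y x with rfl | hne
      · simp at hy
      · simpa [hne] using hy
    · obtain ⟨h', hh', e⟩ := key y h hh w
      obtain ⟨k', hk', e'⟩ := key z k hk w'
      rw [e, e']
      exact η.2.2.2 y z hyz h' hh' k' hk' w w' hw
  refine Set.Finite.of_finite_image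
    (f := fun v => (⟨_, hmem v⟩ : (homComplex G (K.power H)).Face)) (Set.toFinite _) ?_
  intro v hv w _ h
  have h1 := congrFun (congrArg Subtype.val h) x
  simp only [Function.update_self, Finset.singleton_inj] at h1
  by_contra hne
  have h2 := congrFun h1 v
  rw [Function.update_self, Function.update_of_ne hne] at h2
  exact hv h2.symm

/-- Supplies the same hypothesis when `H` may be infinite but the complex is finite: a pair `(x, v)`
with two values comes from two members of a nontrivial factor that differ at `v`, and there are
finitely many such triples. -/
theorem finite_homPowerValues_of_finite_face [Finite (homComplex G (K.power H)).Face]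
    (η : (homComplex G (K.power H)).Face) :
    {p | 1 < (homPowerValues G H K η p).card}.Finite := by
  have h : (⋃ x ∈ {x | 1 < (η.1 x).card}, ⋃ f ∈ (η.1 x : Set (VH → VK)),
      ⋃ g ∈ (η.1 x : Set (VH → VK)), Prod.mk x '' {v | f v ≠ g v}).Finite :=
    η.2.2.1.biUnion fun x _ => (η.1 x).finite_toSet.biUnion' fun f hf =>
      (η.1 x).finite_toSet.biUnion' fun g hg =>
        (finite_ne_of_finite_face G H K η hf hg).image _
  refine h.subset ?_
  rintro ⟨x, v⟩ hv
  obtain ⟨a, ha, b, hb, hab⟩ := Finset.one_lt_card.1 hv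
  obtain ⟨f, hf, rfl⟩ := (mem_homPowerValues G H K).1 ha
  obtain ⟨g, hg, rfl⟩ := (mem_homPowerValues G H K).1 hb
  have hne : f ≠ g := fun h => hab (h ▸ rfl)
  exact Set.mem_biUnion (Finset.one_lt_card.2 ⟨f, hf, g, hg, hne⟩ : x ∈ {x | 1 < (η.1 x).card})
    (Set.mem_biUnion hf (Set.mem_biUnion hg ⟨v, hab, rfl⟩))

open scoped Classical in
/-- The decomposition of the clique complex of the graph of homomorphisms. -/
def cliqueDecomposition [Finite VH] :
    ProductDecomposition ((K.power H).induce {f | H.IsHom K f}).cliqueComplex.toProdsimplicial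
      (homComplex H K) where
  r _ := ()
  π v f := f.1 v
  l η :=
      ⟨fun v => (η.1 ()).image fun f => f.1 v, fun v => η.2.1.image _, Set.toFinite _,
      fun v w hvw a ha b hb => by
        obtain ⟨f, hf, rfl⟩ := Finset.mem_image.1 ha
        obtain ⟨g, hg, rfl⟩ := Finset.mem_image.1 hb
        -- Cliques only make distinct vertices adjacent; for `f = g` the required loop in `K ^ H` is
        -- the fact that `f` is a homomorphism.
        rcases eq_or_ne f g with rfl | hne
        · exact f.2 v w hvw
        · exact η.2.2 hf hg hne v w hvw⟩
  u θ :=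
    have hhom : ∀ f g : VH → VK, (∀ v, f v ∈ θ.1 v) → (∀ v, g v ∈ θ.1 v) →
        (K.power H).Adj f g := fun f g hf hg v w hvw => θ.2.2.2 v w hvw _ (hf v) _ (hg w)
    have hfin : {f : {f | H.IsHom K f} | ∀ v, f.1 v ∈ θ.1 v}.Finite :=
      (finite_setOf_forall_mem θ.1 θ.2.2.1).preimage Subtype.val_injective.injOn
    ⟨fun _ => hfin.toFinset, by
      choose f hf using θ.2.1
      exact ⟨⟨f, hhom f f hf hf⟩, hfin.mem_toFinset.2 hf⟩,
      fun f hf g hg _ => hhom f.1 g.1 (hfin.mem_toFinset.1 hf) (hfin.mem_toFinset.1 hg)⟩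
  mem_l η k b := by simp
  mem_u θ x f := by simp
  ext x f g h := Subtype.ext (funext fun v => h v rfl)
  exists_eq θ x b hb :=
    ⟨⟨b, fun v w hvw => θ.2.2.2 v w hvw _ (hb v) _ (hb w)⟩, fun _ _ => rfl⟩

theorem ProdsimplicialComplex.HomotopyEquivalent.symm {ι κ A B : Type*}
    {X : ProdsimplicialComplex ι A} {Y : ProdsimplicialComplex κ B}
    (h : X.HomotopyEquivalent Y) : Y.HomotopyEquivalent X :=
  h.map ContinuousMap.HomotopyEquiv.symm
end

/-! ### The theorem, from the three decompositions. -/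

theorem mainTheorem6 {VG VH VK : Type*}
    (G : LoopGraph VG) (H : LoopGraph VH) (K : LoopGraph VK) :
    -- the homotopy equivalence for products in the second argument
    (homComplex G (H.prod K)).HomotopyEquivalent ((homComplex G H).prod (homComplex G K)) ∧
    -- the collapse behind it, and simplicity, when the complex is finite
    (Finite (homComplex G (H.prod K)).Face →
      (∃ e : (homComplex G H).Face × (homComplex G K).Face ↪o (homComplex G (H.prod K)).Face,
        (∀ η θ x, (e (η, θ)).1 x = η.1 x ×ˢ θ.1 x) ∧
        (homComplex G (H.prod K)).Bd.CollapsesOnto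
          ((orderComplex ((homComplex G H).Face × (homComplex G K).Face)).image e) ∧
        ((orderComplex ((homComplex G H).Face × (homComplex G K).Face)).image e).IsSubdivision
          ((homComplex G H).prod (homComplex G K))) ∧
      (homComplex G (H.prod K)).SimpleHomotopyEquivalent
        ((homComplex G H).prod (homComplex G K))) ∧
    -- the homotopy equivalence for products in the first argument
    (Finite VH →
      (homComplex (G.prod H) K).HomotopyEquivalent (homComplex G (K.power H))) ∧
    -- the collapse behind it, and simplicity, when the complex is finite
    (Finite (homComplex G (K.power H)).Face →
      (∃ e : (homComplex (G.prod H) K).Face ↪o (homComplex G (K.power H)).Face,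
        (∀ η x f, f ∈ (e η).1 x ↔ ∀ v, f v ∈ η.1 (x, v)) ∧
        (homComplex G (K.power H)).Bd.CollapsesOnto ((homComplex (G.prod H) K).Bd.image e)) ∧
      (homComplex (G.prod H) K).SimpleHomotopyEquivalent (homComplex G (K.power H))) ∧
    -- the clique complex of the subgraph of the power graph induced by the homomorphisms
    (Finite VH →
      (homComplex H K).HomotopyEquivalent
        ((K.power H).induce {f | H.IsHom K f}).cliqueComplex.toProdsimplicial) := by
  refine ⟨?_, fun _ => ⟨?_, (homProdDecomposition G H K).simpleHomotopyEquivalent⟩, fun _ => ?_,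
    fun _ => ?_, fun _ => ?_⟩
  · have : ∀ x, Fintype {k // (homProdDecomposition G H K).r k = x} := fun x => by
      have : Finite {k // (homProdDecomposition G H K).r k = x} := by
        refine Set.Finite.to_subtype ((Set.toFinite {Sum.inl x, Sum.inr x}).subset ?_)
        rintro (k | k) rfl
        exacts [Or.inl rfl, Or.inr rfl]
      exact Fintype.ofFinite _
    exact (homProdDecomposition G H K).homotopyEquivalent
  · let D := homProdDecomposition G H K
    have : Finite ((homComplex G H).prod (homComplex G K)).Face :=
      Finite.of_injective _ D.embedding.injective
    let i := ProdsimplicialComplex.faceProd (homComplex G H) (homComplex G K)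
    -- The copy of the order complex of the product poset is the copy of the barycentric subdivision
    -- of the product complex, as the two posets are isomorphic; the general results then apply.
    have himage : (orderComplex _).image (i.toOrderEmbedding.trans D.embedding) =
        ((homComplex G H).prod (homComplex G K)).Bd.image D.embedding.toEmbedding := by
      rw [ProdsimplicialComplex.Bd, ← PreAbstractSimplicialComplex.orderComplex_image i,
        PreAbstractSimplicialComplex.image_image]
      rfl
    refine ⟨i.toOrderEmbedding.trans D.embedding, fun η θ x => ?_, ?_, ?_⟩
    · change (homProdMk G H K (i.symm (i (η, θ)))).1 x = _
      rw [OrderIso.symm_apply_apply]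
      rfl
    · rw [himage]
      exact D.collapsesOnto
    · rw [himage]
      exact PreAbstractSimplicialComplex.isSubdivision_image_Bd _
  · let D := homPowerDecomposition G H K (finite_homPowerValues G H K)
    have : ∀ x, Fintype {k // D.r k = x} := fun x => by
      have : Finite {k // D.r k = x} := by
        refine Set.Finite.to_subtype ((Set.finite_range (Prod.mk x)).subset ?_)
        rintro ⟨_, v⟩ rfl
        exact ⟨v, rfl⟩
      exact Fintype.ofFinite _
    exact D.homotopyEquivalent.symm
  · let D := homPowerDecomposition G H K (finite_homPowerValues_of_finite_face G H K)
    exact ⟨⟨D.embedding, fun η x f => mem_homPowerSections G H K, D.collapsesOnto⟩,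
      D.simpleHomotopyEquivalent.symm⟩
  · have : ∀ x, Fintype {k // (cliqueDecomposition H K).r k = x} := fun x => Fintype.ofFinite _
    exact (cliqueDecomposition H K).homotopyEquivalent.symm
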